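/- Let $m\ge 1$ and $\mathscr C=[0,1]^m$. For $q\in L_2(\mathscr C)$ let $\varrho_q(\mathbf k)=\int_{\mathscr C}q(\mathbf x)e^{-2\pi i\mathbf k\cdot\mathbf x}\,d\mathbf x$, $\mathbf k\in\mathbb Z^m$, be its Fourier coefficients and, for real $s>0$, let $\mathcal M(s)$ be the set of all $q\in L_2(\mathscr C)$ with $\sum_{\mathbf k}(1+\|\mathbf k\|^2)^s|\varrho_q(\mathbf k)|^2<\infty$ and $\sum_{\mathbf k}\|\mathbf k\|^s|\varrho_q(\mathbf k)|<\infty$, where $\|\cdot\|$ is the Euclidean norm. Let $\mathcal M_1(s)=\{q\in\mathcal M(s):\sup_{\mathbf x\in\mathscr C}|q(\mathbf x)|\le 1\}$ be the unit ball of $(\mathcal M(s),\|\cdot\|_\infty)$. Let $s_0>0$, $b\ge 0$, and let $\theta:\mathscr C\to\mathbb R$ belong to $\mathcal M(s_0)$. Let $\psi\in L_2(\mathscr C)$ be positive with $\int_{\mathscr C}\psi=1$, extended periodically, and put $[K\theta](\mathbf x)=\int_{\mathscr C}\theta(\mathbf u)\psi(\mathbf x-\mathbf u)\,d\mathbf u$.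 Assume that there are constants $\gamma>0$ and $0\le C<C^*<\infty$ such that the Fourier coefficients $\Psi$ of $\psi$ satisfy $C\le\|\mathbf k\|^b|\Psi(\mathbf k)|<C^*$ whenever $\|\mathbf k\|>\gamma$. Observe $Y_j=[K\theta](X_j)+\varepsilon_j$, $j\ge 1$, where $X_1,X_2,\dots$ are i.i.d. with Lebesgue density $g$ on $\mathscr C$, $\inf_{\mathscr C}g>0$, $\sup_{\mathscr C}g<\infty$, $g\in\mathcal M(s_0+b+m)$; the errors $\varepsilon_1,\varepsilon_2,\dots$ are i.i.d. with mean zero, a Lebesgue density, and $E|\varepsilon_1|^\kappa<\infty$ for some $\kappa>2$; and the sequences $(X_j)$ and $(\varepsilon_j)$ are independent. Let $\Lambda:\mathbb R^m\to\mathbb C$ satisfy $\Lambda(\mathbf u)=1$ for $\|\mathbf u\|\le 1$, $|\Lambda(\mathbf u)|\le 1$ for $\|\mathbf u\|>1$, $\int\|\mathbf u\||\Lambda(\mathbf u)|\,d\mathbf u<\infty$ and, with $p=\max\{s_0+b,1\}$, $\int\|\mathbf u\|^{p}|\Lambda(\mathbf u)|\,d\mathbf u<\infty$, the latter integral having a finite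 upper Riemann sum: $\sum_{\mathbf k\in\mathbb Z^m}\sup_{\mathbf u\in\mathbf k+[0,1)^m}\|\mathbf u\|^{p}|\Lambda(\mathbf u)|<\infty$. Let the bandwidths $c_n$ be of exact order $n^{-1/(2s_0+2b+3m)}\log^{1/(2s_0+2b+3m)}(n)$, that is, for all large $n$, between two positive constant multiples of this quantity. Put $$\hat g(\mathbf x)=\frac1n\sum_{j=1}^n\sum_{\mathbf k\in\mathbb Z^m}\Lambda(c_n\mathbf k)e^{2\pi i\mathbf k\cdot(\mathbf x-X_j)},\quad \hat R(\mathbf k)=\frac1n\sum_{j=1}^n\frac{Y_j}{\hat g(X_j)}e^{-2\pi i\mathbf k\cdot X_j},\quad \widehat{K\theta}(\mathbf x)=\sum_{\mathbf k\in\mathbb Z^m}\Lambda(c_n\mathbf k)\hat R(\mathbf k)e^{2\pi i\mathbf k\cdot\mathbf x}.$$ Then, almost surely, the estimator is well defined for all sufficiently large $n$ (the series $\sum_{\mathbf k}\Lambda(c_n\mathbf k)$ converges absolutely and $\hat g(X_j)\ne 0$ for $j\le n$), $$\sup_{\mathbf x\in\mathscr C}\big|\widehat{K\theta}(\mathbf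 x)-K\theta(\mathbf x)\big|=O\Big(n^{-(s_0+b)/(2s_0+2b+3m)}\log^{(s_0+b)/(2s_0+2b+3m)}(n)\Big)\quad\text{a.s.,}$$ and, almost surely, $\widehat{K\theta}-K\theta\in\mathcal M_1(s_0+b)$ for all sufficiently large $n$. -/

import Mathlib

open MeasureTheory ProbabilityTheory Filter Topology

noncomputable section

namespace IndirectRegression

/-- The unit cube `[0,1]^m`, the support of the covariates. -/
def cube (m : ℕ) : Set (Fin m → ℝ) := Set.Icc 0 1

/-- A frequency `k ∈ ℤ^m`, seen as a vector of Euclidean space; its norm is the Euclidean norm. -/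
def freq {m : ℕ} (k : Fin m → ℤ) : EuclideanSpace ℝ (Fin m) :=
  WithLp.toLp 2 (fun i => (k i : ℝ))

/-- The Fourier basis function `exp(2πi k·x)`. -/
def expi {m : ℕ} (k : Fin m → ℤ) (x : Fin m → ℝ) : ℂ :=
  Complex.exp (2 * Real.pi * Complex.I * ((∑ i, (k i : ℝ) * x i : ℝ) : ℂ))

/-- The Fourier coefficient `∫_{[0,1]^m} q(x) exp(-2πi k·x) dx`. -/
def fourierCoef {m : ℕ} (q : (Fin m → ℝ) → ℂ) (k : Fin m → ℤ) : ℂ :=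
  ∫ x in cube m, q x * expi (-k) x

/-- The space `M(s)`: the periodic Sobolev space of real order `s` (square-integrable functions on
the cube with `∑ (1 + ‖k‖²)^s |ϱ(k)|² < ∞`), intersected with the functions whose Fourier
coefficients satisfy `∑ ‖k‖^s |ϱ(k)| < ∞`. -/
def MSpace (m : ℕ) (s : ℝ) : Set ((Fin m → ℝ) → ℂ) :=
  {q | MemLp q 2 (volume.restrict (cube m)) ∧
    (Summable fun k : Fin m → ℤ => (1 + ‖freq k‖ ^ 2) ^ s * ‖fourierCoef q k‖ ^ 2) ∧
    (Summable fun k : Fin m → ℤ => ‖freq k‖ ^ s * ‖fourierCoef q k‖)}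

/-- The unit ball of `M(s)` for the supremum norm on the cube. -/
def MUnitBall (m : ℕ) (s : ℝ) : Set ((Fin m → ℝ) → ℂ) :=
  {q | q ∈ MSpace m s ∧ ∀ x ∈ cube m, ‖q x‖ ≤ 1}

/-- The `ℤ^m`-periodic extension of (the restriction to `[0,1)^m` of) a function. -/
def periodize {m : ℕ} (ψ : (Fin m → ℝ) → ℝ) (x : Fin m → ℝ) : ℝ :=
  ψ (fun i => Int.fract (x i))

/-- The convolution operator `[Kθ](x) = ∫_{[0,1]^m} θ(u) ψ(x - u) du`, `ψ` being extended
periodically. -/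
def convOp {m : ℕ} (ψ θ : (Fin m → ℝ) → ℝ) (x : Fin m → ℝ) : ℝ :=
  ∫ u in cube m, θ u * periodize ψ (x - u)

/-- The distortion function: a square-integrable positive function on the cube of integral `1`. -/
structure IsDistortion {m : ℕ} (ψ : (Fin m → ℝ) → ℝ) : Prop where
  memLp : MemLp ψ 2 (volume.restrict (cube m))
  pos : ∀ᵐ x ∂(volume.restrict (cube m)), 0 < ψ x
  integral_eq_one : ∫ x in cube m, ψ x = 1

/-- Ill-posedness of degree `b`. The lower constant may be zero. -/
def IllPosed {m : ℕ} (ψ : (Fin m → ℝ) → ℝ) (b : ℝ) : Prop :=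
  ∃ γ C C' : ℝ, 0 < γ ∧ 0 ≤ C ∧ C < C' ∧ ∀ k : Fin m → ℤ, γ < ‖freq k‖ →
    C ≤ ‖freq k‖ ^ b * ‖fourierCoef (fun x => (ψ x : ℂ)) k‖ ∧
    ‖freq k‖ ^ b * ‖fourierCoef (fun x => (ψ x : ℂ)) k‖ < C'

/-- `Λ` has a finite moment `∫ ‖u‖^p |Λ(u)| du`. -/
def FiniteMoment {m : ℕ} (Λ : EuclideanSpace ℝ (Fin m) → ℂ) (p : ℝ) : Prop :=
  Integrable (fun u : EuclideanSpace ℝ (Fin m) => ‖u‖ ^ p * ‖Λ u‖) volume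

/-- The integral `∫ ‖u‖^p |Λ(u)| du` has a finite upper Riemann sum over the cubes
`k + [0,1)^m`, `k ∈ ℤ^m`: the suprema of the integrand over these cubes are summable. -/
def FiniteUpperSum {m : ℕ} (Λ : EuclideanSpace ℝ (Fin m) → ℂ) (p : ℝ) : Prop :=
  ∃ M : (Fin m → ℤ) → ℝ, Summable M ∧
    ∀ (k : Fin m → ℤ) (u : EuclideanSpace ℝ (Fin m)),
      (∀ i, (k i : ℝ) ≤ u i ∧ u i < (k i : ℝ) + 1) → ‖u‖ ^ p * ‖Λ u‖ ≤ M k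

/-- A Fourier smoothing kernel: `Λ = 1` on the closed unit ball, `|Λ| ≤ 1` outside it, and a finite
first moment. -/
structure IsSmoothingKernel {m : ℕ} (Λ : EuclideanSpace ℝ (Fin m) → ℂ) : Prop where
  eq_one : ∀ u, ‖u‖ ≤ 1 → Λ u = 1
  norm_le_one : ∀ u, 1 < ‖u‖ → ‖Λ u‖ ≤ 1
  moment_one : FiniteMoment Λ 1

/-- The covariate density: in `M(s)`, bounded, and bounded away from zero on the cube. -/
structure IsCovariateDensity {m : ℕ} (g : (Fin m → ℝ) → ℝ) (s : ℝ) : Prop where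
  bounded_below : ∃ δ : ℝ, 0 < δ ∧ ∀ x ∈ cube m, δ ≤ g x
  bounded_above : ∃ B : ℝ, ∀ x ∈ cube m, g x ≤ B
  mem : (fun x => (g x : ℂ)) ∈ MSpace m s

/-- The smoothing weight `W_c(x) = ∑_k Λ(c k) exp(2πi k·x)`. -/
def weight {m : ℕ} (Λ : EuclideanSpace ℝ (Fin m) → ℂ) (c : ℝ) (x : Fin m → ℝ) : ℂ :=
  ∑' k : Fin m → ℤ, Λ (c • freq k) * expi k x

/-- The density estimator `ĝ(x) = n⁻¹ ∑_{j<n} W_c(x - X_j)`. -/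
def densityEst {m : ℕ} (Λ : EuclideanSpace ℝ (Fin m) → ℂ) (c : ℝ) (n : ℕ)
    (X : ℕ → Fin m → ℝ) (x : Fin m → ℝ) : ℂ :=
  (1 / (n : ℂ)) * ∑ j ∈ Finset.range n, weight Λ c (x - X j)

/-- The estimated Fourier coefficient `R̂(k) = n⁻¹ ∑_{j<n} (Y_j / ĝ(X_j)) exp(-2πi k·X_j)`. -/
def coefEst {m : ℕ} (Λ : EuclideanSpace ℝ (Fin m) → ℂ) (c : ℝ) (n : ℕ)
    (X : ℕ → Fin m → ℝ) (Y : ℕ → ℝ) (k : Fin m → ℤ) : ℂ :=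
  (1 / (n : ℂ)) * ∑ j ∈ Finset.range n,
    (Y j : ℂ) / densityEst Λ c n X (X j) * expi (-k) (X j)

/-- The Fourier series estimator `∑_k Λ(c k) R̂(k) exp(2πi k·x)` of `Kθ`. -/
def regressionEst {m : ℕ} (Λ : EuclideanSpace ℝ (Fin m) → ℂ) (c : ℝ) (n : ℕ)
    (X : ℕ → Fin m → ℝ) (Y : ℕ → ℝ) (x : Fin m → ℝ) : ℂ :=
  ∑' k : Fin m → ℤ, Λ (c • freq k) * coefEst Λ c n X Y k * expi k x

/-- The rate `n^{-a} log^a(n)`. -/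
def logRate (a : ℝ) (n : ℕ) : ℝ := (n : ℝ) ^ (-a) * (Real.log n) ^ a

end IndirectRegression

end

/-!
The estimation error is controlled frequency by frequency. Write `s = s₀ + b`, `N = 2s + 3m` and
`u = (log n / n)^{1/N}`, so that the bandwidth `c` is of exact order `u`, the sampled kernel
`Λ(c k)` has `ℓ¹` norm of order `u^{-m}` (`exists_kernel_sum_le`), and the fluctuation rate
`ρ = (log n / n)^{1/2}` equals `u^{s + 3m/2}`.

* *Stochastic part.* By Hoeffding's inequality and the Borel–Cantelli lemma, empirical Fourier
  coefficients `n⁻¹ ∑ a_j q(X_j) exp(-2πi k·X_j)` with bounded `q` deviate from their expectations by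
  `O(ρ)`, uniformly in `‖k‖ ≤ n²` (`ae_eventually_deviation_le`). The errors `ε_j` enter as weights
  `a_j`: they are independent of the covariates, so that the bound can be applied conditionally on
  the errors, and only their mean squares matter
  (`ae_eventually_deviation_le_of_indepFun`). Since `∫ exp(-2πi k·x) dx = 0` for `k ≠ 0`, the noise
  part `ε_j / g(X_j)` has a conditional mean only at frequency zero, and there the mean of the
  errors is controlled by an `L²`-bounded martingale (`ae_exists_abs_mean_le`).

* *Bias.* `Kθ` is everywhere the sum of its Fourier series (`convOp_eq_tsum`), whose coefficients
  have a finite moment of order `s` (`summable_convCoef`); as `Λ = 1` on the unit ball, the smoothing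
  bias is `O(u^s)` (`IsSmoothingKernel.bias_le`).

* *Estimated density.* The same argument gives `|ĝ - g| = O(u^{-m} ρ + u^{s + m}) = O(u^{s + m/2})`
  at the sample points. Replacing `ĝ` by `g` in the estimator costs this rate times
  `n⁻¹ ∑ |Y_j| |W_c(x - X_j)|`, which by the Cauchy–Schwarz inequality is of the order `u^{-m/2}` of
  the `L²` norm of `W_c`: the empirical second moment of `W_c`, weighted by `1 / g(X_j)`, is a double
  sum over frequencies whose expectation is its diagonal (`sum_mul_norm_weight_sq_le`). The product
  is `O(u^s)`.

The error is itself a trigonometric series whose coefficients have a finite moment of order `s`, and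
hence a member of `M(s)`; its supremum is eventually at most one because `u` tends to zero.
-/

namespace IndirectRegression

/-! ### Trigonometric series on the cube -/

section Characters

variable {m : ℕ}

lemma norm_expi (k : Fin m → ℤ) (x : Fin m → ℝ) : ‖expi k x‖ = 1 := by
  have h : expi k x = Complex.exp (((2 * Real.pi * ∑ i, (k i : ℝ) * x i : ℝ) : ℂ) * Complex.I) := by
    unfold expi
    congr 1
    push_cast
    ring
  rw [h, Complex.norm_exp_ofReal_mul_I]

lemma expi_add (k l : Fin m → ℤ) (x : Fin m → ℝ) : expi (k + l) x = expi k x * expi l x := by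
  unfold expi
  rw [← Complex.exp_add]
  congr 1
  simp only [Pi.add_apply, Int.cast_add, add_mul, Finset.sum_add_distrib]
  push_cast
  ring

@[simp] lemma expi_zero (x : Fin m → ℝ) : expi 0 x = 1 := by
  simp [expi]

lemma expi_sub_right (k : Fin m → ℤ) (x y : Fin m → ℝ) :
    expi k (x - y) = expi k x * expi (-k) y := by
  unfold expi
  rw [← Complex.exp_add]
  congr 1
  simp only [Pi.sub_apply, Pi.neg_apply, Int.cast_neg, mul_sub, neg_mul, Finset.sum_sub_distrib,
    Finset.sum_neg_distrib]
  push_cast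
  ring

lemma star_expi (k : Fin m → ℤ) (x : Fin m → ℝ) : star (expi k x) = expi (-k) x := by
  have h := Complex.mul_conj (expi k x)
  rw [Complex.normSq_eq_norm_sq, norm_expi] at h
  have h2 : expi k x * expi (-k) x = 1 := by rw [← expi_add]; simp
  have h3 : expi k x ≠ 0 := by
    rw [← norm_ne_zero_iff, norm_expi]; exact one_ne_zero
  apply mul_left_cancel₀ h3
  rw [h2]
  simpa using h

@[fun_prop]
lemma continuous_expi (k : Fin m → ℤ) : Continuous (expi k) := by
  unfold expi
  fun_prop

end Characters

section Torus

variable {m : ℕ}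

-- The theory of multivariate Fourier series normalizes the measure on the circle to have mass one.
noncomputable local instance : MeasureSpace UnitAddCircle := ⟨AddCircle.haarAddCircle⟩

local instance : Measure.IsAddHaarMeasure (volume : Measure UnitAddCircle) :=
  inferInstanceAs (Measure.IsAddHaarMeasure AddCircle.haarAddCircle)

local instance : IsProbabilityMeasure (volume : Measure UnitAddCircle) :=
  inferInstanceAs (IsProbabilityMeasure AddCircle.haarAddCircle)

local instance : Measure.IsNegInvariant (volume : Measure UnitAddCircle) :=
  Measure.IsAddHaarMeasure.isNegInvariant_of_innerRegular _

local instance : Measure.IsNegInvariant (volume : Measure (UnitAddTorus (Fin m))) :=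
  inferInstanceAs (Measure.IsNegInvariant (Measure.pi fun _ : Fin m =>
    (volume : Measure UnitAddCircle)))

/-- The covering map `ℝ^m → ℝ^m / ℤ^m`. -/
noncomputable def toTorus (x : Fin m → ℝ) : UnitAddTorus (Fin m) := fun i => (x i : UnitAddCircle)

/-- The section of the covering map with values in `[0,1)^m`. -/
noncomputable def torusRep (t : UnitAddTorus (Fin m)) : Fin m → ℝ :=
  fun i => (AddCircle.equivIco 1 0 (t i) : ℝ)

lemma torusRep_toTorus (x : Fin m → ℝ) : torusRep (toTorus x) = fun i => Int.fract (x i) := by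
  funext i
  simp [torusRep, toTorus]

lemma ae_fract_eq : ∀ᵐ x ∂(volume.restrict (cube m)), (fun i => Int.fract (x i)) = x := by
  have h : (Set.univ.pi fun i : Fin m => Set.Ico ((0 : Fin m → ℝ) i) ((1 : Fin m → ℝ) i))
      =ᵐ[volume] cube m := Measure.univ_pi_Ico_ae_eq_Icc
  rw [← Measure.restrict_congr_set h]
  refine (ae_restrict_iff' (MeasurableSet.univ_pi fun i => measurableSet_Ico)).2 (ae_of_all _ ?_)
  intro x hx
  funext i
  have := hx i (Set.mem_univ i)
  exact Int.fract_eq_self.2 ⟨by simpa using this.1, by simpa using this.2⟩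

lemma measurePreserving_toTorus :
    MeasurePreserving (toTorus (m := m)) (volume.restrict (cube m)) volume := by
  have h : (Set.univ.pi fun i : Fin m => Set.Ioc ((0 : Fin m → ℝ) i) ((1 : Fin m → ℝ) i))
      =ᵐ[volume] cube m := Measure.univ_pi_Ioc_ae_eq_Icc
  rw [← Measure.restrict_congr_set h, volume_pi, Measure.restrict_pi_pi]
  have h1 : MeasurePreserving ((↑) : ℝ → UnitAddCircle)
      (volume.restrict (Set.Ioc (0 : ℝ) 1)) AddCircle.haarAddCircle := by
    have := AddCircle.measurePreserving_mk (1 : ℝ) 0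
    rw [AddCircle.volume_eq_smul_haarAddCircle] at this
    simpa using this
  exact measurePreserving_pi _ _ fun i => h1

lemma measurable_torusRep : Measurable (torusRep (m := m)) := by
  refine measurable_pi_lambda _ fun i => ?_
  exact (measurable_subtype_coe.comp (AddCircle.measurableEquivIco 1 0).measurable).comp
    (measurable_pi_apply i)

lemma measurePreserving_torusRep :
    MeasurePreserving (torusRep (m := m)) volume (volume.restrict (cube m)) := by
  refine ⟨measurable_torusRep, ?_⟩
  rw [← measurePreserving_toTorus.map_eq,
    Measure.map_map measurable_torusRep measurePreserving_toTorus.measurable]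
  have : (torusRep ∘ toTorus) =ᵐ[volume.restrict (cube m)] (id : (Fin m → ℝ) → _) := by
    filter_upwards [ae_fract_eq] with x hx
    simp only [Function.comp, torusRep_toTorus, hx, id]
  rw [Measure.map_congr this, Measure.map_id]

lemma expi_eq_mFourier (k : Fin m → ℤ) (x : Fin m → ℝ) :
    expi k x = UnitAddTorus.mFourier k (toTorus x) := by
  simp only [expi, UnitAddTorus.mFourier, toTorus, ContinuousMap.coe_mk, fourier_coe_apply,
    ← Complex.exp_sum]
  congr 1
  push_cast
  rw [Finset.mul_sum]
  refine Finset.sum_congr rfl fun i _ => ?_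
  ring

lemma integral_cube_eq_torus (F : UnitAddTorus (Fin m) → ℂ)
    (hF : AEStronglyMeasurable F volume) :
    ∫ x in cube m, F (toTorus x) = ∫ t, F t := by
  rw [← measurePreserving_toTorus.map_eq, integral_map
    measurePreserving_toTorus.measurable.aemeasurable]
  rwa [measurePreserving_toTorus.map_eq]

lemma integral_cube_eq_torusRep (q : (Fin m → ℝ) → ℂ)
    (hq : AEStronglyMeasurable q (volume.restrict (cube m))) :
    ∫ x in cube m, q x = ∫ t, q (torusRep t) := by
  rw [← measurePreserving_torusRep.map_eq, integral_map
    measurePreserving_torusRep.measurable.aemeasurable]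
  rwa [measurePreserving_torusRep.map_eq]

lemma expi_torusRep (k : Fin m → ℤ) (t : UnitAddTorus (Fin m)) :
    expi k (torusRep t) = UnitAddTorus.mFourier k t := by
  rw [expi_eq_mFourier]
  congr 1
  funext i
  exact (AddCircle.equivIco 1 0).symm_apply_apply (t i)

lemma mFourierCoeff_torusRep (q : (Fin m → ℝ) → ℂ)
    (hq : AEStronglyMeasurable q (volume.restrict (cube m))) (k : Fin m → ℤ) :
    UnitAddTorus.mFourierCoeff (fun t => q (torusRep t)) k = fourierCoef q k := by
  unfold UnitAddTorus.mFourierCoeff fourierCoef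
  rw [integral_cube_eq_torusRep (fun x => q x * expi (-k) x)
    (hq.mul (continuous_expi _).aestronglyMeasurable)]
  simp only [expi_torusRep, smul_eq_mul, mul_comm]

/-- A square-integrable function on the cube with absolutely summable Fourier coefficients is almost
everywhere the sum of its Fourier series. -/
theorem ae_eq_tsum_fourierCoef (q : (Fin m → ℝ) → ℂ)
    (hq : MemLp q 2 (volume.restrict (cube m))) (hs : Summable fun k => ‖fourierCoef q k‖) :
    ∀ᵐ x ∂(volume.restrict (cube m)), q x = ∑' k, fourierCoef q k * expi k x := by
  have hQ : MemLp (fun t => q (torusRep t)) 2 (volume : Measure (UnitAddTorus (Fin m))) :=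
    hq.comp_measurePreserving measurePreserving_torusRep
  set f : Lp ℂ 2 (volume : Measure (UnitAddTorus (Fin m))) := hQ.toLp with hf
  have hc : ∀ k, UnitAddTorus.mFourierCoeff f k = fourierCoef q k := by
    intro k
    rw [← mFourierCoeff_torusRep q hq.1]
    refine integral_congr_ae ?_
    filter_upwards [hQ.coeFn_toLp] with t ht
    rw [ht]
  have hS : Summable fun k => fourierCoef q k • UnitAddTorus.mFourier k := by
    refine Summable.of_norm ?_
    simpa only [norm_smul, UnitAddTorus.mFourier_norm, mul_one] using hs
  obtain ⟨F, hF⟩ := hS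
  have h1 : HasSum (fun k => fourierCoef q k • UnitAddTorus.mFourierLp 2 k)
      (ContinuousMap.toLp (E := ℂ) 2 (volume : Measure (UnitAddTorus (Fin m))) ℂ F) := by
    have := (ContinuousMap.toLp (E := ℂ) 2
      (volume : Measure (UnitAddTorus (Fin m))) ℂ).hasSum hF
    simpa only [map_smul] using this
  have h2 := UnitAddTorus.hasSum_mFourier_series_L2 f
  simp only [hc] at h2
  have h3 := h2.unique h1
  have h4 : (fun t => q (torusRep t)) =ᵐ[volume] F := by
    refine hQ.coeFn_toLp.symm.trans ?_
    rw [← hf, h3]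
    exact ContinuousMap.coeFn_toLp _ F
  have h5 := measurePreserving_toTorus.quasiMeasurePreserving.ae h4
  filter_upwards [h5, ae_fract_eq] with x hx hx'
  rw [torusRep_toTorus, hx'] at hx
  rw [hx]
  have h6 : HasSum (fun k => (fourierCoef q k • UnitAddTorus.mFourier k) (toTorus x))
      (F (toTorus x)) := ContinuousMap.hasSum_apply hF _
  rw [← h6.tsum_eq]
  refine tsum_congr fun k => ?_
  simp [expi_eq_mFourier]

lemma mFourier_sub (k : Fin m → ℤ) (t u : UnitAddTorus (Fin m)) :
    UnitAddTorus.mFourier k (t - u) =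
      UnitAddTorus.mFourier k t * UnitAddTorus.mFourier (-k) u := by
  have ht : toTorus (torusRep t) = t := by
    funext i
    exact (AddCircle.equivIco 1 0).symm_apply_apply (t i)
  have hu : toTorus (torusRep u) = u := by
    funext i
    exact (AddCircle.equivIco 1 0).symm_apply_apply (u i)
  have h : t - u = toTorus (torusRep t - torusRep u) := by
    conv_lhs => rw [← ht, ← hu]
    funext i
    simp [toTorus]
  rw [h, ← expi_eq_mFourier, expi_sub_right, expi_torusRep, expi_torusRep]

lemma periodize_sub_eq (ψ : (Fin m → ℝ) → ℝ) (x u : Fin m → ℝ) :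
    periodize ψ (x - u) = ψ (torusRep (toTorus x - toTorus u)) := by
  unfold periodize
  have h : toTorus x - toTorus u = toTorus (x - u) := by
    funext i
    simp [toTorus]
  rw [h, torusRep_toTorus]

lemma integrable_periodize_sub (ψ : (Fin m → ℝ) → ℝ) (hψ : IntegrableOn ψ (cube m))
    (x : Fin m → ℝ) : IntegrableOn (fun u => periodize ψ (x - u)) (cube m) := by
  have h1 : Integrable (fun t : UnitAddTorus (Fin m) => ψ (torusRep t)) volume :=
    measurePreserving_torusRep.integrable_comp_of_integrable hψ
  have h2 := h1.comp_sub_left (toTorus x)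
  have h3 := measurePreserving_toTorus.integrable_comp_of_integrable h2
  refine h3.congr (ae_of_all _ fun u => ?_)
  simp only [Function.comp, periodize_sub_eq]

/-- The convolution with a periodic function is diagonal in the Fourier basis. -/
lemma integral_expi_mul_periodize (ψ : (Fin m → ℝ) → ℝ) (hψ : IntegrableOn ψ (cube m))
    (x : Fin m → ℝ) (k : Fin m → ℤ) :
    ∫ u in cube m, expi k u * (periodize ψ (x - u) : ℂ) =
      fourierCoef (fun x => (ψ x : ℂ)) k * expi k x := by
  have h1 : Integrable (fun t : UnitAddTorus (Fin m) => (ψ (torusRep t) : ℂ)) volume :=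
    (measurePreserving_torusRep.integrable_comp_of_integrable hψ).ofReal
  simp only [periodize_sub_eq, expi_eq_mFourier]
  rw [integral_cube_eq_torus (fun t => UnitAddTorus.mFourier k t *
    (ψ (torusRep (toTorus x - t)) : ℂ))
    ((UnitAddTorus.mFourier k).continuous.aestronglyMeasurable.mul
      (h1.comp_sub_left (toTorus x)).1)]
  have e : ∀ t, UnitAddTorus.mFourier k t * (ψ (torusRep (toTorus x - t)) : ℂ) =
      (fun t => UnitAddTorus.mFourier k (toTorus x - t) * (ψ (torusRep t) : ℂ))
        (toTorus x - t) := by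
    intro t
    simp
  simp only [e]
  rw [integral_sub_left_eq_self (fun t => UnitAddTorus.mFourier k (toTorus x - t) *
    (ψ (torusRep t) : ℂ))]
  rw [← mFourierCoeff_torusRep (fun x => (ψ x : ℂ))
    (Complex.continuous_ofReal.comp_aestronglyMeasurable hψ.1)]
  unfold UnitAddTorus.mFourierCoeff
  rw [← integral_mul_const]
  refine integral_congr_ae (ae_of_all _ fun t => ?_)
  simp only [mFourier_sub, smul_eq_mul]
  ring

lemma fourierCoef_expi (k l : Fin m → ℤ) :
    fourierCoef (expi k) l = if k = l then 1 else 0 := by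
  have h := orthonormal_iff_ite.1 (UnitAddTorus.orthonormal_mFourier (d := Fin m)) l k
  rw [ContinuousMap.inner_toLp] at h
  rw [← mFourierCoeff_torusRep _ (continuous_expi k).aestronglyMeasurable]
  unfold UnitAddTorus.mFourierCoeff
  simp only [expi_torusRep, smul_eq_mul]
  simp only [eq_comm (a := k)]
  rw [← h]
  refine integral_congr_ae (ae_of_all _ fun t => ?_)
  simp [UnitAddTorus.mFourier_neg, mul_comm]

end Torus

/-! ### Absolutely convergent trigonometric series and the spaces `M(s)` -/

section TrigSeries

variable {m : ℕ}

@[simp] lemma freq_zero : freq (0 : Fin m → ℤ) = 0 := by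
  ext i; simp [freq]

lemma freq_sub (k l : Fin m → ℤ) : freq (k - l) = freq k - freq l := by
  ext i; simp [freq]

lemma abs_le_norm_freq (k : Fin m → ℤ) (i : Fin m) : |(k i : ℝ)| ≤ ‖freq k‖ := by
  have := PiLp.norm_apply_le (freq k) i
  simpa [freq] using this

lemma one_le_norm_freq {k : Fin m → ℤ} (hk : k ≠ 0) : 1 ≤ ‖freq k‖ := by
  obtain ⟨i, hi⟩ := Function.ne_iff.1 hk
  refine le_trans ?_ (abs_le_norm_freq k i)
  rw [← Int.cast_abs]
  exact_mod_cast Int.one_le_abs hi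

lemma summable_of_summable_rpow {s : ℝ} (hs : 0 < s) {a : (Fin m → ℤ) → ℝ} (ha : ∀ k, 0 ≤ a k)
    (h : Summable fun k => ‖freq k‖ ^ s * a k) : Summable a := by
  classical
  rw [← (Finset.summable_compl_iff {(0 : Fin m → ℤ)})]
  have h' := (Finset.summable_compl_iff {(0 : Fin m → ℤ)}).2 h
  refine h'.of_nonneg_of_le (fun k => ha _) fun k => ?_
  have hk : (k : Fin m → ℤ) ≠ 0 := by simpa using k.2
  exact le_mul_of_one_le_left (ha _) (Real.one_le_rpow (one_le_norm_freq hk) hs.le)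

lemma summable_mul_expi {a : (Fin m → ℤ) → ℂ} (ha : Summable fun k => ‖a k‖) (x : Fin m → ℝ) :
    Summable fun k => a k * expi k x := by
  refine Summable.of_norm ?_
  simpa only [norm_mul, norm_expi, mul_one] using ha

lemma continuous_tsum_expi {a : (Fin m → ℤ) → ℂ} (ha : Summable fun k => ‖a k‖) :
    Continuous fun x => ∑' k, a k * expi k x := by
  refine continuous_tsum (fun k => by fun_prop) ha fun k x => ?_
  rw [norm_mul, norm_expi, mul_one]

lemma norm_tsum_expi_le {a : (Fin m → ℤ) → ℂ} (ha : Summable fun k => ‖a k‖) (x : Fin m → ℝ) :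
    ‖∑' k, a k * expi k x‖ ≤ ∑' k, ‖a k‖ := by
  refine (norm_tsum_le_tsum_norm ?_).trans (le_of_eq ?_)
  · simpa only [norm_mul, norm_expi, mul_one] using ha
  · simp only [norm_mul, norm_expi, mul_one]

instance isFiniteMeasure_cube : IsFiniteMeasure (volume.restrict (cube m)) := by
  refine ⟨?_⟩
  rw [Measure.restrict_apply_univ]
  exact isCompact_Icc.measure_lt_top

lemma fourierCoef_tsum {a : (Fin m → ℤ) → ℂ} (ha : Summable fun k => ‖a k‖) (l : Fin m → ℤ) :
    fourierCoef (fun x => ∑' k, a k * expi k x) l = a l := by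
  have hint : ∀ k, Integrable (fun x => a k * expi k x * expi (-l) x)
      (volume.restrict (cube m)) := fun k =>
    Integrable.of_bound (by fun_prop) (‖a k‖)
      (ae_of_all _ fun x => by simp [norm_expi])
  have h := hasSum_integral_of_summable_integral_norm hint (by
    simp only [norm_mul, norm_expi, mul_one, integral_const]
    exact ha.const_smul _)
  have h2 : ∀ k, ∫ x in cube m, a k * expi k x * expi (-l) x = if k = l then a k else 0 := by
    intro k
    simp only [mul_assoc]
    rw [integral_const_mul]
    have := fourierCoef_expi k l
    unfold fourierCoef at this
    rw [this]
    simp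
  simp only [h2] at h
  have h3 : HasSum (fun k => if k = l then a k else 0) (a l) := by
    convert! hasSum_ite_eq l (a l) using 2 with k
    split_ifs with hk <;> simp [hk]
  unfold fourierCoef
  rw [← h.unique h3]
  refine integral_congr_ae (ae_of_all _ fun x => ?_)
  simp only [tsum_mul_right]

/-- A trigonometric series whose coefficients have a finite moment of order `s > 0` belongs to
`M(s)`: the `ℓ²` condition follows from the `ℓ¹` condition. -/
lemma tsum_mem_MSpace {s : ℝ} (hs : 0 < s) {a : (Fin m → ℤ) → ℂ}
    (h : Summable fun k => ‖freq k‖ ^ s * ‖a k‖) :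
    (fun x => ∑' k, a k * expi k x) ∈ MSpace m s := by
  have ha := summable_of_summable_rpow hs (fun k => norm_nonneg (a k)) h
  refine ⟨?_, ?_, ?_⟩
  · exact MemLp.of_bound (continuous_tsum_expi ha).aestronglyMeasurable _
      (ae_of_all _ fun x => norm_tsum_expi_le ha x)
  · simp only [fourierCoef_tsum ha]
    have h1 : Summable fun k => (‖a k‖ + ‖freq k‖ ^ s * ‖a k‖) := ha.add h
    have h2 : Summable fun k => (‖a k‖ + ‖freq k‖ ^ s * ‖a k‖) ^ 2 := by
      have h0 : ∀ k, 0 ≤ ‖a k‖ + ‖freq k‖ ^ s * ‖a k‖ := fun k => by positivity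
      refine (h1.mul_left (∑' k, (‖a k‖ + ‖freq k‖ ^ s * ‖a k‖))).of_nonneg_of_le
        (fun k => by positivity) fun k => ?_
      rw [sq]
      exact mul_le_mul_of_nonneg_right (h1.le_tsum k fun j _ => h0 j) (h0 k)
    refine (h2.mul_left (2 ^ s)).of_nonneg_of_le (fun k => by positivity) fun k => ?_
    rcases eq_or_ne k 0 with rfl | hk
    · simp only [freq_zero, norm_zero, Real.zero_rpow hs.ne']
      have : (1 : ℝ) ≤ 2 ^ s := Real.one_le_rpow (by norm_num) hs.le
      simp
      nlinarith [sq_nonneg ‖a 0‖]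
    · have h3 := one_le_norm_freq hk
      have h4 : (1 + ‖freq k‖ ^ 2) ^ s ≤ 2 ^ s * (‖freq k‖ ^ s) ^ 2 := by
        rw [← Real.rpow_natCast (‖freq k‖ ^ s), ← Real.rpow_mul (norm_nonneg _),
          mul_comm s, Real.rpow_mul (norm_nonneg _), ← Real.mul_rpow (by norm_num) (by positivity)]
        refine Real.rpow_le_rpow (by positivity) ?_ hs.le
        norm_num
        nlinarith
      calc (1 + ‖freq k‖ ^ 2) ^ s * ‖a k‖ ^ 2 ≤ 2 ^ s * (‖freq k‖ ^ s) ^ 2 * ‖a k‖ ^ 2 := by gcongr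
        _ = 2 ^ s * (‖freq k‖ ^ s * ‖a k‖) ^ 2 := by ring
        _ ≤ _ := by
          gcongr
          linarith [norm_nonneg (a k)]
  · simpa only [fourierCoef_tsum ha] using h

end TrigSeries

/-! ### The convolution operator in the Fourier domain -/

section Convolution

variable {m : ℕ}

lemma IsDistortion.integrableOn {ψ : (Fin m → ℝ) → ℝ} (hψ : IsDistortion ψ) :
    IntegrableOn ψ (cube m) :=
  hψ.memLp.integrable (by norm_num)

lemma MSpace.summable_norm {s : ℝ} (hs : 0 < s) {q : (Fin m → ℝ) → ℂ} (hq : q ∈ MSpace m s) :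
    Summable fun k => ‖fourierCoef q k‖ :=
  summable_of_summable_rpow hs (fun _ => norm_nonneg _) hq.2.2

/-- The Fourier coefficients of the convolution `Kθ`. -/
noncomputable def convCoef (ψ θ : (Fin m → ℝ) → ℝ) (k : Fin m → ℤ) : ℂ :=
  fourierCoef (fun x => (θ x : ℂ)) k * fourierCoef (fun x => (ψ x : ℂ)) k

lemma norm_fourierCoef_le (q : (Fin m → ℝ) → ℂ) (k : Fin m → ℤ) :
    ‖fourierCoef q k‖ ≤ ∫ x in cube m, ‖q x‖ := by
  refine (norm_integral_le_integral_norm _).trans (le_of_eq ?_)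
  simp [norm_expi]

/-- The Fourier series of `Kθ` converges to `Kθ` at every point, although `θ` is the sum of its own
Fourier series only almost everywhere. -/
lemma convOp_eq_tsum {ψ θ : (Fin m → ℝ) → ℝ} {s : ℝ} (hs : 0 < s)
    (hθ : (fun x => (θ x : ℂ)) ∈ MSpace m s) (hψ : IsDistortion ψ) (x : Fin m → ℝ) :
    (convOp ψ θ x : ℂ) = ∑' k, convCoef ψ θ k * expi k x := by
  have hsum := MSpace.summable_norm hs hθ
  have hint := integrable_periodize_sub ψ hψ.integrableOn x
  have h1 : (convOp ψ θ x : ℂ) = ∫ u in cube m, ∑' k,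
      fourierCoef (fun x => (θ x : ℂ)) k * (expi k u * (periodize ψ (x - u) : ℂ)) := by
    unfold convOp
    rw [← integral_complex_ofReal]
    refine integral_congr_ae ?_
    filter_upwards [ae_eq_tsum_fourierCoef _ hθ.1 hsum] with u hu
    rw [Complex.ofReal_mul, hu, ← tsum_mul_right]
    simp only [mul_assoc]
  have hi : ∀ k, Integrable (fun u => fourierCoef (fun x => (θ x : ℂ)) k *
      (expi k u * (periodize ψ (x - u) : ℂ))) (volume.restrict (cube m)) := by
    intro k
    refine Integrable.const_mul ?_ _
    refine hint.ofReal.bdd_mul (c := 1) (by fun_prop) ?_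
    exact ae_of_all _ fun u => by rw [norm_expi]
  have h2 := hasSum_integral_of_summable_integral_norm hi (by
    simp only [norm_mul, norm_expi, one_mul, Complex.norm_real, integral_const_mul]
    exact hsum.mul_right _)
  rw [h1, ← h2.tsum_eq]
  refine tsum_congr fun k => ?_
  rw [integral_const_mul, integral_expi_mul_periodize ψ hψ.integrableOn, convCoef, mul_assoc]

/-- Convolution with an ill-posed distortion of degree `b` gains `b` orders of smoothness. -/
lemma summable_convCoef {ψ θ : (Fin m → ℝ) → ℝ} {s b : ℝ} (hs : 0 < s) (hb : 0 ≤ b)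
    (hθ : (fun x => (θ x : ℂ)) ∈ MSpace m s) (hψb : IllPosed ψ b) :
    Summable fun k => ‖freq k‖ ^ (s + b) * ‖convCoef ψ θ k‖ := by
  obtain ⟨γ, C, C', hγ, -, -, h⟩ := hψb
  set I := ∫ x in cube m, ‖(ψ x : ℂ)‖ with hI
  have hI0 : 0 ≤ I := integral_nonneg fun _ => norm_nonneg _
  have hbd : ∀ k : Fin m → ℤ,
      ‖freq k‖ ^ b * ‖fourierCoef (fun x => (ψ x : ℂ)) k‖ ≤ max C' (γ ^ b * I) := by
    intro k
    by_cases hk : γ < ‖freq k‖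
    · exact (h k hk).2.le.trans (le_max_left _ _)
    · refine le_trans ?_ (le_max_right _ _)
      gcongr
      · exact not_lt.1 hk
      · exact norm_fourierCoef_le _ k
  refine (hθ.2.2.mul_right (max C' (γ ^ b * I))).of_nonneg_of_le (fun k => by positivity)
    fun k => ?_
  rcases eq_or_ne k 0 with rfl | hk
  · simp [Real.zero_rpow (show s + b ≠ 0 by positivity), Real.zero_rpow hs.ne']
  · have h0 : 0 < ‖freq k‖ := lt_of_lt_of_le one_pos (one_le_norm_freq hk)
    rw [Real.rpow_add h0, convCoef, norm_mul]
    calc _ = ‖freq k‖ ^ s * ‖fourierCoef (fun x => (θ x : ℂ)) k‖ *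
          (‖freq k‖ ^ b * ‖fourierCoef (fun x => (ψ x : ℂ)) k‖) := by ring
      _ ≤ _ := by gcongr; exact hbd k

end Convolution

/-! ### Lattice sums of the smoothing kernel -/

section Kernel

variable {m : ℕ}

/-- Comparison of a sum over the lattice `c ℤ^m` with an upper Riemann sum over unit cubes: a unit
cube contains at most `⌈1/c⌉^m` points of the lattice, since a lattice point is determined by its
unit cube together with its index modulo `⌈1/c⌉`. -/
lemma tsum_lattice_le {F : EuclideanSpace ℝ (Fin m) → ℝ} {M : (Fin m → ℤ) → ℝ}
    (hF : ∀ u, 0 ≤ F u) (hM0 : ∀ l, 0 ≤ M l) (hM : Summable M)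
    (hFM : ∀ u : EuclideanSpace ℝ (Fin m), F u ≤ M fun i => ⌊u i⌋)
    {c : ℝ} (hc : 0 < c) (hc1 : c ≤ 1) :
    (Summable fun k : Fin m → ℤ => F (c • freq k)) ∧
      ∑' k : Fin m → ℤ, F (c • freq k) ≤ (2 * c⁻¹) ^ m * ∑' l, M l := by
  set q : ℕ := ⌈c⁻¹⌉₊ with hq
  have hcinv : 1 ≤ c⁻¹ := (one_le_inv₀ hc).2 hc1
  have hq0 : 0 < q := Nat.ceil_pos.2 (by positivity)
  have : NeZero q := ⟨hq0.ne'⟩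
  have hq1 : c⁻¹ ≤ q := Nat.le_ceil _
  have hq2 : (q : ℝ) ≤ 2 * c⁻¹ := by
    have := (Nat.ceil_lt_add_one (by positivity : 0 ≤ c⁻¹)).le
    linarith
  set j : (Fin m → ℤ) → (Fin m → ZMod q) × (Fin m → ℤ) :=
    fun k => (fun i => (k i : ZMod q), fun i => ⌊c * k i⌋) with hj
  have hinj : Function.Injective j := by
    intro k l hkl
    simp only [hj, Prod.mk.injEq] at hkl
    funext i
    have h1 := congrFun hkl.1 i
    have h2 := congrFun hkl.2 i
    have h3 : |c * (k i : ℝ) - c * (l i : ℝ)| < 1 := Int.abs_sub_lt_one_of_floor_eq_floor h2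
    have h4 : (q : ℤ) ∣ k i - l i := by
      rw [← ZMod.intCast_zmod_eq_zero_iff_dvd]
      push_cast
      exact sub_eq_zero.2 h1
    have h5 : |((k i - l i : ℤ) : ℝ)| < q := by
      rw [← mul_sub, abs_mul, abs_of_pos hc] at h3
      push_cast
      refine lt_of_lt_of_le ?_ hq1
      rwa [← one_div, lt_div_iff₀' hc]
    have h6 : |k i - l i| < q := by exact_mod_cast h5
    have := Int.eq_zero_of_abs_lt_dvd h4 h6
    omega
  have hG : HasSum (fun p : (Fin m → ZMod q) × (Fin m → ℤ) => M p.2) (q ^ m * ∑' l, M l) := by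
    have hs : Summable fun p : (Fin m → ZMod q) × (Fin m → ℤ) => M p.2 := by
      rw [summable_prod_of_nonneg fun p => hM0 _]
      exact ⟨fun _ => hM, Summable.of_finite⟩
    have := hs.tsum_prod
    rw [tsum_fintype (fun _ : Fin m → ZMod q => ∑' l, M l)] at this
    simp only [Finset.sum_const, Finset.card_univ, Fintype.card_fun, ZMod.card, Fintype.card_fin,
      nsmul_eq_mul, Nat.cast_pow] at this
    rw [← this]
    exact hs.hasSum
  have hcomp : Summable fun k => M (j k).2 := hG.summable.comp_injective hinj
  have hle : ∀ k : Fin m → ℤ, F (c • freq k) ≤ M (j k).2 := by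
    intro k
    refine (hFM _).trans (le_of_eq ?_)
    simp [hj, freq]
  have hsum : Summable fun k : Fin m → ℤ => F (c • freq k) :=
    hcomp.of_nonneg_of_le (fun k => hF _) hle
  refine ⟨hsum, (hsum.tsum_le_tsum hle hcomp).trans ?_⟩
  have h7 : ∑' k, M (j k).2 ≤ ∑' p : (Fin m → ZMod q) × (Fin m → ℤ), M p.2 :=
    tsum_comp_le_tsum_of_inj hG.summable (fun p => hM0 _) hinj
  rw [hG.tsum_eq] at h7
  refine h7.trans ?_
  have : 0 ≤ ∑' l, M l := tsum_nonneg hM0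
  gcongr

lemma IsSmoothingKernel.norm_le {Λ : EuclideanSpace ℝ (Fin m) → ℂ} (hΛ : IsSmoothingKernel Λ)
    (u : EuclideanSpace ℝ (Fin m)) : ‖Λ u‖ ≤ 1 := by
  by_cases h : ‖u‖ ≤ 1
  · rw [hΛ.eq_one u h, norm_one]
  · exact hΛ.norm_le_one u (not_le.1 h)

/-- Weighted `ℓ¹` bound for the sampled kernel: there are of order `c^{-m}` effective
frequencies. -/
lemma exists_kernel_sum_le {Λ : EuclideanSpace ℝ (Fin m) → ℂ} (hΛ : IsSmoothingKernel Λ)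
    {p : ℝ} (hp : 0 ≤ p) (hΛr : FiniteUpperSum Λ p) :
    ∃ C : ℝ, 0 < C ∧ ∀ c : ℝ, 0 < c → c ≤ 1 →
      (Summable fun k : Fin m → ℤ => (1 + ‖c • freq k‖ ^ p) * ‖Λ (c • freq k)‖) ∧
      ∑' k : Fin m → ℤ, (1 + ‖c • freq k‖ ^ p) * ‖Λ (c • freq k)‖ ≤ C * (c⁻¹) ^ m := by
  classical
  obtain ⟨M, hM, hMb⟩ := hΛr
  have hfl : ∀ (u : EuclideanSpace ℝ (Fin m)) (i : Fin m),
      ((⌊u i⌋ : ℤ) : ℝ) ≤ u i ∧ u i < ((⌊u i⌋ : ℤ) : ℝ) + 1 :=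
    fun u i => ⟨Int.floor_le _, Int.lt_floor_add_one _⟩
  have hM0 : ∀ l, 0 ≤ M l := fun l =>
    le_trans (by positivity) (hMb l (freq l) fun i => by simp [freq])
  set S : Finset (Fin m → ℤ) := Finset.Icc (fun _ => -1) (fun _ => 1) with hS
  set M' : (Fin m → ℤ) → ℝ := fun l => 2 * M l + if l ∈ S then 2 else 0 with hM'
  have hM'0 : ∀ l, 0 ≤ M' l := fun l => by
    have := hM0 l
    simp only [hM']
    split_ifs <;> linarith
  have hM's : Summable M' := by
    refine (hM.mul_left 2).add (summable_of_ne_finset_zero (s := S) fun l hl => ?_)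
    simp [hl]
  have hFM : ∀ u : EuclideanSpace ℝ (Fin m), (1 + ‖u‖ ^ p) * ‖Λ u‖ ≤ M' fun i => ⌊u i⌋ := by
    intro u
    by_cases hu : ‖u‖ ≤ 1
    · have hin : (fun i => ⌊u i⌋) ∈ S := by
        rw [hS, Finset.mem_Icc]
        have hui : ∀ i, |u i| ≤ 1 := fun i => (PiLp.norm_apply_le u i).trans hu
        refine ⟨fun i => ?_, fun i => ?_⟩
        · rw [Int.le_floor]
          push_cast
          linarith [(abs_le.1 (hui i)).1]
        · rw [← Int.lt_add_one_iff, Int.floor_lt]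
          push_cast
          linarith [(abs_le.1 (hui i)).2]
      have h1 : ‖u‖ ^ p ≤ 1 := Real.rpow_le_one (norm_nonneg _) hu hp
      have h2 := hΛ.norm_le u
      have h3 := hM0 fun i => ⌊u i⌋
      simp only [hM', hin, if_true]
      have : (1 + ‖u‖ ^ p) * ‖Λ u‖ ≤ 2 * 1 := by
        gcongr
        linarith
      linarith
    · have h1 : 1 ≤ ‖u‖ ^ p := Real.one_le_rpow (not_le.1 hu).le hp
      have h2 := hMb (fun i => ⌊u i⌋) u (hfl u)
      have h3 := norm_nonneg (Λ u)
      have h4 : (0 : ℝ) ≤ if (fun i => ⌊u i⌋) ∈ S then 2 else 0 := by split_ifs <;> norm_num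
      simp only [hM']
      nlinarith
  refine ⟨2 ^ m * (∑' l, M' l + 1), ?_, fun c hc hc1 => ?_⟩
  · have : 0 ≤ ∑' l, M' l := tsum_nonneg hM'0
    positivity
  · obtain ⟨h1, h2⟩ := tsum_lattice_le (F := fun u => (1 + ‖u‖ ^ p) * ‖Λ u‖)
      (fun u => by positivity) hM'0 hM's hFM hc hc1
    refine ⟨h1, h2.trans ?_⟩
    rw [mul_pow, mul_right_comm]
    gcongr
    linarith

end Kernel

/-! ### Uniform deviations of weighted empirical Fourier coefficients -/

section Deviation

variable {α Ω : Type*} [MeasurableSpace α] [MeasurableSpace Ω]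

lemma measure_weighted_sum_ge_le {P : Measure Ω} [IsProbabilityMeasure P] {ν : Measure α}
    {X : ℕ → Ω → α} (hX : ∀ j, Measurable (X j)) (hlaw : ∀ j, P.map (X j) = ν)
    (hind : iIndepFun X P) {φ : α → ℝ} (hφ : Measurable φ) {B : ℝ} (hφB : ∀ x, |φ x| ≤ B)
    (a : ℕ → ℝ) (n : ℕ) {S : ℝ} (hS : ∑ j ∈ Finset.range n, a j ^ 2 ≤ S)
    {t : ℝ} (ht : 0 ≤ t) :
    P.real {ω | t ≤ ∑ j ∈ Finset.range n, a j * (φ (X j ω) - ∫ x, φ x ∂ν)} ≤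
      Real.exp (-t ^ 2 / (2 * (B ^ 2 * S))) := by
  have hS0 : 0 ≤ S := (Finset.sum_nonneg fun j _ => sq_nonneg (a j)).trans hS
  have hmean : ∀ j, ∫ ω, φ (X j ω) ∂P = ∫ x, φ x ∂ν := by
    intro j
    rw [← hlaw j, integral_map (hX j).aemeasurable hφ.aestronglyMeasurable]
  have hsub : ∀ j, HasSubgaussianMGF (fun ω => a j * (φ (X j ω) - ∫ x, φ x ∂ν))
      ((‖|a j| * B - -(|a j| * B)‖₊ / 2) ^ 2) P := by
    intro j
    have h := hasSubgaussianMGF_of_mem_Icc (μ := P) (X := fun ω => a j * φ (X j ω))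
      (a := -(|a j| * B)) (b := |a j| * B) ((hφ.comp (hX j)).const_mul _).aemeasurable
      (ae_of_all _ fun ω => by
        have : |a j * φ (X j ω)| ≤ |a j| * B := by
          rw [abs_mul]
          exact mul_le_mul_of_nonneg_left (hφB _) (abs_nonneg _)
        exact abs_le.1 this)
    simpa only [integral_const_mul, hmean, ← mul_sub] using h
  have hind' : iIndepFun (fun j ω => a j * (φ (X j ω) - ∫ x, φ x ∂ν)) P :=
    hind.comp (fun j x => a j * (φ x - ∫ x, φ x ∂ν)) fun j =>
      (hφ.sub_const _).const_mul _
  have hsum := HasSubgaussianMGF.sum_of_iIndepFun hind' (s := Finset.range n)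
    fun j _ => hsub j
  have hle : ((∑ j ∈ Finset.range n, (‖|a j| * B - -(|a j| * B)‖₊ / 2) ^ 2 : NNReal) : ℝ)
      ≤ B ^ 2 * S := by
    push_cast
    calc _ = ∑ j ∈ Finset.range n, B ^ 2 * a j ^ 2 := by
          refine Finset.sum_congr rfl fun j _ => ?_
          rw [sub_neg_eq_add, ← two_mul, Real.norm_eq_abs, div_pow, sq_abs, mul_pow, mul_pow,
            sq_abs]
          ring
      _ ≤ _ := by
          rw [← Finset.mul_sum]
          gcongr
  have hsum' : HasSubgaussianMGF (fun ω => ∑ j ∈ Finset.range n,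
      a j * (φ (X j ω) - ∫ x, φ x ∂ν)) ⟨B ^ 2 * S, by positivity⟩ P := by
    refine ⟨hsum.integrable_exp_mul, fun u => (hsum.mgf_le u).trans ?_⟩
    rw [Real.exp_le_exp]
    have : 0 ≤ u ^ 2 := sq_nonneg u
    have h2 := mul_le_mul_of_nonneg_right hle this
    change _ ≤ B ^ 2 * S * u ^ 2 / 2
    linarith
  exact hsum'.measure_ge_le ht

lemma measure_abs_weighted_sum_ge_le {P : Measure Ω} [IsProbabilityMeasure P] {ν : Measure α}
    {X : ℕ → Ω → α} (hX : ∀ j, Measurable (X j)) (hlaw : ∀ j, P.map (X j) = ν)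
    (hind : iIndepFun X P) {φ : α → ℝ} (hφ : Measurable φ) {B : ℝ} (hφB : ∀ x, |φ x| ≤ B)
    (a : ℕ → ℝ) (n : ℕ) {S : ℝ} (hS : ∑ j ∈ Finset.range n, a j ^ 2 ≤ S)
    {t : ℝ} (ht : 0 ≤ t) :
    P.real {ω | t ≤ |∑ j ∈ Finset.range n, a j * (φ (X j ω) - ∫ x, φ x ∂ν)|} ≤
      2 * Real.exp (-t ^ 2 / (2 * (B ^ 2 * S))) := by
  have h1 := measure_weighted_sum_ge_le hX hlaw hind hφ hφB a n hS ht
  have h2 := measure_weighted_sum_ge_le hX hlaw hind hφ hφB (fun j => - a j) n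
    (by simpa using hS) ht
  rw [two_mul]
  refine le_trans (measureReal_mono ?_ (measure_ne_top _ _))
    ((measureReal_union_le _ _).trans (add_le_add h1 h2))
  intro ω hω
  simp only [Set.mem_ofPred_eq, le_abs] at hω
  simpa [Finset.sum_neg_distrib] using hω

lemma measure_norm_weighted_sum_ge_le {P : Measure Ω} [IsProbabilityMeasure P] {ν : Measure α}
    [IsProbabilityMeasure ν]
    {X : ℕ → Ω → α} (hX : ∀ j, Measurable (X j)) (hlaw : ∀ j, P.map (X j) = ν)
    (hind : iIndepFun X P) {φ : α → ℂ} (hφ : Measurable φ) {B : ℝ} (hφB : ∀ x, ‖φ x‖ ≤ B)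
    (a : ℕ → ℝ) (n : ℕ) {S : ℝ} (hS : ∑ j ∈ Finset.range n, a j ^ 2 ≤ S)
    {t : ℝ} (ht : 0 ≤ t) :
    P.real {ω | 2 * t ≤ ‖∑ j ∈ Finset.range n, (a j : ℂ) * (φ (X j ω) - ∫ x, φ x ∂ν)‖} ≤
      4 * Real.exp (-t ^ 2 / (2 * (B ^ 2 * S))) := by
  have hint : Integrable φ ν := Integrable.of_bound hφ.aestronglyMeasurable B (ae_of_all _ hφB)
  have h1 := measure_abs_weighted_sum_ge_le hX hlaw hind (φ := fun x => (φ x).re)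
    (Complex.measurable_re.comp hφ) (fun x => (Complex.abs_re_le_norm _).trans (hφB x)) a n hS ht
  have h2 := measure_abs_weighted_sum_ge_le hX hlaw hind (φ := fun x => (φ x).im)
    (Complex.measurable_im.comp hφ) (fun x => (Complex.abs_im_le_norm _).trans (hφB x)) a n hS ht
  have e1 : ∫ x, (φ x).re ∂ν = (∫ x, φ x ∂ν).re := integral_re hint
  have e2 : ∫ x, (φ x).im ∂ν = (∫ x, φ x ∂ν).im := integral_im hint
  rw [e1] at h1
  rw [e2] at h2
  have e3 : (4 : ℝ) * Real.exp (-t ^ 2 / (2 * (B ^ 2 * S))) =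
      2 * Real.exp (-t ^ 2 / (2 * (B ^ 2 * S))) + 2 * Real.exp (-t ^ 2 / (2 * (B ^ 2 * S))) := by
    ring
  rw [e3]
  refine le_trans (measureReal_mono ?_ (measure_ne_top _ _))
    ((measureReal_union_le _ _).trans (add_le_add h1 h2))
  intro ω hω
  simp only [Set.mem_ofPred_eq, Set.mem_union] at hω ⊢
  have h3 := Complex.norm_le_abs_re_add_abs_im
    (∑ j ∈ Finset.range n, (a j : ℂ) * (φ (X j ω) - ∫ x, φ x ∂ν))
  simp only [Complex.re_sum, Complex.im_sum, Complex.re_ofReal_mul, Complex.im_ofReal_mul,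
    Complex.sub_re, Complex.sub_im] at h3
  by_contra hcon
  simp only [not_or, not_le] at hcon
  linarith [hcon.1, hcon.2]

/-- The deviation of the weighted empirical mean of `φ` along the sample `x` from its expectation
under `ν`. -/
noncomputable def deviation (ν : Measure α) (φ : α → ℂ) (a : ℕ → ℝ) (x : ℕ → α) (n : ℕ) : ℂ :=
  (1 / (n : ℂ)) * ∑ j ∈ Finset.range n, (a j : ℂ) * (φ (x j) - ∫ y, φ y ∂ν)

/-- The uniform fluctuation rate `(log n / n)^{1/2}` of empirical Fourier coefficients. -/
noncomputable def rho (n : ℕ) : ℝ := Real.sqrt (Real.log n / n)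

lemma norm_deviation_le {ν : Measure α} [IsProbabilityMeasure ν] {φ : α → ℂ} {B V : ℝ}
    (hφB : ∀ x, ‖φ x‖ ≤ B) (a : ℕ → ℝ) (x : ℕ → α) {n : ℕ}
    (hn : 1 ≤ n) (hV : ∑ j ∈ Finset.range n, a j ^ 2 ≤ V * n) :
    ‖deviation ν φ a x n‖ ≤ B * (1 + V) := by
  have hn' : (0 : ℝ) < n := by exact_mod_cast hn
  have hI : ‖∫ y, φ y ∂ν‖ ≤ B := by
    simpa using norm_integral_le_of_norm_le_const (μ := ν) (ae_of_all _ hφB)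
  have hB : 0 ≤ B := (norm_nonneg _).trans hI
  unfold deviation
  rw [norm_mul, norm_div, norm_one, Complex.norm_natCast, one_div_mul_eq_div, div_le_iff₀ hn']
  calc _ ≤ ∑ j ∈ Finset.range n, B * (1 + a j ^ 2) := by
        refine norm_sum_le_of_le _ fun j _ => ?_
        rw [norm_mul, Complex.norm_real, Real.norm_eq_abs]
        have h1 : ‖φ (x j) - ∫ y, φ y ∂ν‖ ≤ 2 * B := by
          refine (norm_sub_le _ _).trans ?_
          linarith [hφB (x j)]
        have h2 : |a j| * 2 ≤ 1 + a j ^ 2 := by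
          rw [← sq_abs]
          nlinarith [sq_nonneg (|a j| - 1)]
        calc _ ≤ |a j| * (2 * B) := by gcongr
          _ = B * (|a j| * 2) := by ring
          _ ≤ _ := by gcongr
    _ = B * (n + ∑ j ∈ Finset.range n, a j ^ 2) := by
        rw [← Finset.mul_sum, Finset.sum_add_distrib]
        simp
    _ ≤ B * (n + V * n) := by gcongr
    _ = _ := by ring

/-- The constant of the uniform deviation inequality for functions bounded by `B` and weights whose
mean square is at most `V`; Hoeffding's inequality beats the number of order `n^{2m}` of frequencies
with `‖k‖ ≤ n²`. -/
noncomputable def devConst (m : ℕ) (B V : ℝ) : ℝ :=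
  2 * Real.sqrt (2 * B ^ 2 * V * (2 * m + 2)) + B * (1 + V)

/-- Uniform strong deviation bound for weighted empirical Fourier coefficients, with deterministic
weights. The summand `‖k‖ / n²` takes care of the infinitely many frequencies beyond `n²`, for which
only the trivial bound is used. -/
theorem ae_eventually_deviation_le {m : ℕ} {P : Measure Ω} [IsProbabilityMeasure P]
    {ν : Measure α} [IsProbabilityMeasure ν]
    {X : ℕ → Ω → α} (hX : ∀ j, Measurable (X j)) (hlaw : ∀ j, P.map (X j) = ν)
    (hind : iIndepFun X P) {φ : (Fin m → ℤ) → α → ℂ} (hφ : ∀ k, Measurable (φ k)) {B : ℝ}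
    (hB : 0 < B) (hφB : ∀ k x, ‖φ k x‖ ≤ B) (a : ℕ → ℝ) {V : ℝ} (hV : 0 < V)
    (haV : ∀ᶠ n : ℕ in atTop, ∑ j ∈ Finset.range n, a j ^ 2 ≤ V * n) :
    ∀ᵐ ω ∂P, ∀ᶠ n : ℕ in atTop, ∀ k,
      ‖deviation ν (φ k) a (fun j => X j ω) n‖
        ≤ devConst m B V * (rho n + ‖freq k‖ / (n : ℝ) ^ 2) := by
  classical
  set τ : ℝ := Real.sqrt (2 * B ^ 2 * V * (2 * m + 2)) with hτ
  have hτ2 : τ ^ 2 = 2 * B ^ 2 * V * (2 * m + 2) := Real.sq_sqrt (by positivity)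
  set t : ℕ → ℝ := fun n => τ * Real.sqrt (n * Real.log n) with ht
  have ht0 : ∀ n, 0 ≤ t n := fun n => by positivity
  set box : ℕ → Finset (Fin m → ℤ) := fun n => Finset.Icc (fun _ => -(n : ℤ) ^ 2)
    (fun _ => (n : ℤ) ^ 2) with hbox
  set E : ℕ → (Fin m → ℤ) → Set Ω := fun n k =>
    {ω | 2 * t n ≤ ‖∑ j ∈ Finset.range n, (a j : ℂ) * (φ k (X j ω) - ∫ x, φ k x ∂ν)‖} with hE
  set s : ℕ → Set Ω := fun n =>
    {ω | (1 ≤ n ∧ ∑ j ∈ Finset.range n, a j ^ 2 ≤ V * n) ∧ ω ∈ ⋃ k ∈ box n, E n k} with hs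
  have hPs : ∀ n, P (s n) ≤ ENNReal.ofReal (4 * 3 ^ m * (1 / (n : ℝ) ^ 2)) := by
    intro n
    by_cases hn : 1 ≤ n ∧ ∑ j ∈ Finset.range n, a j ^ 2 ≤ V * n
    · have hn' : (1 : ℝ) ≤ n := by exact_mod_cast hn.1
      have hlog : 0 ≤ Real.log n := Real.log_nonneg hn'
      have hEk : ∀ k, P.real (E n k) ≤ 4 * (1 / (n : ℝ) ^ (2 * m + 2)) := by
        intro k
        refine (measure_norm_weighted_sum_ge_le hX hlaw hind (hφ k) (hφB k) a n hn.2
          (ht0 n)).trans (le_of_eq ?_)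
        congr 1
        have h1 : -t n ^ 2 / (2 * (B ^ 2 * (V * n))) = -(((2 * m + 2 : ℕ) : ℝ) * Real.log n) := by
          simp only [ht, mul_pow, hτ2]
          rw [Real.sq_sqrt (by positivity)]
          push_cast
          field_simp
        rw [h1, Real.exp_neg, ← Real.log_pow, Real.exp_log (by positivity), one_div]
      have hcard : ((box n).card : ℝ) ≤ 3 ^ m * (n : ℝ) ^ (2 * m) := by
        have h1 : (box n).card = (2 * n ^ 2 + 1) ^ m := by
          simp only [hbox, Pi.card_Icc, Int.card_Icc, Finset.prod_const, Finset.card_univ,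
            Fintype.card_fin]
          congr 1
          zify
          rw [Int.toNat_of_nonneg (by linarith [sq_nonneg (n : ℤ)])]
          ring
        rw [h1, pow_mul, ← mul_pow]
        push_cast
        gcongr
        nlinarith
      have h2 : P.real (s n) ≤ 4 * 3 ^ m * (1 / (n : ℝ) ^ 2) := by
        calc P.real (s n) ≤ P.real (⋃ k ∈ box n, E n k) :=
              measureReal_mono (fun ω hω => hω.2) (measure_ne_top _ _)
          _ ≤ ∑ k ∈ box n, P.real (E n k) := measureReal_biUnion_finset_le _ _
          _ ≤ ∑ k ∈ box n, 4 * (1 / (n : ℝ) ^ (2 * m + 2)) := Finset.sum_le_sum fun k _ => hEk k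
          _ = (box n).card * (4 * (1 / (n : ℝ) ^ (2 * m + 2))) := by
              rw [Finset.sum_const, nsmul_eq_mul]
          _ ≤ 3 ^ m * (n : ℝ) ^ (2 * m) * (4 * (1 / (n : ℝ) ^ (2 * m + 2))) := by gcongr
          _ = _ := by
              rw [pow_add]
              field_simp
      rw [← ofReal_measureReal]
      exact ENNReal.ofReal_le_ofReal h2
    · have : s n = ∅ := by
        ext ω
        simp only [hs, Set.mem_ofPred_eq, Set.mem_empty_iff_false, iff_false]
        exact fun h => hn h.1
      rw [this]
      simp
  have hsum : ∑' n, P (s n) ≠ ⊤ := by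
    refine ne_top_of_le_ne_top ?_ (ENNReal.tsum_le_tsum hPs)
    have hsm : Summable fun n : ℕ => 4 * 3 ^ m * (1 / (n : ℝ) ^ 2) :=
      (Real.summable_one_div_nat_pow.2 (by norm_num)).mul_left _
    rw [← ENNReal.ofReal_tsum_of_nonneg (fun n => by positivity) hsm]
    exact ENNReal.ofReal_ne_top
  filter_upwards [ae_eventually_notMem hsum] with ω hω
  filter_upwards [hω, haV, eventually_ge_atTop 1] with n hn hnV hn1 k
  have hn' : (1 : ℝ) ≤ n := by exact_mod_cast hn1
  have hn0 : (0 : ℝ) < n := by linarith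
  have hρ : 0 ≤ rho n := Real.sqrt_nonneg _
  by_cases hk : k ∈ box n
  · have h1 : ¬ (2 * t n ≤ ‖∑ j ∈ Finset.range n,
        (a j : ℂ) * (φ k (X j ω) - ∫ x, φ k x ∂ν)‖) := by
      intro hcon
      exact hn ⟨⟨hn1, hnV⟩, Set.mem_biUnion (by exact hk) hcon⟩
    have h2 : ‖deviation ν (φ k) a (fun j => X j ω) n‖ ≤ 2 * τ * rho n := by
      unfold deviation
      rw [norm_mul, norm_div, norm_one, Complex.norm_natCast, one_div_mul_eq_div,
        div_le_iff₀ hn0]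
      refine (not_le.1 h1).le.trans (le_of_eq ?_)
      have : Real.sqrt (n * Real.log n) = rho n * n := by
        rw [rho, ← Real.sqrt_sq hn0.le, ← Real.sqrt_mul' _ (by positivity), Real.sqrt_sq hn0.le]
        congr 1
        field_simp
      simp only [ht, this]
      ring
    have h3 : 0 ≤ ‖freq k‖ / (n : ℝ) ^ 2 := by positivity
    refine h2.trans ?_
    unfold devConst
    rw [← hτ]
    have h4 : 0 ≤ B * (1 + V) := by positivity
    have h5 : 0 ≤ τ := Real.sqrt_nonneg _
    nlinarith [mul_nonneg h4 hρ, mul_nonneg h4 h3, mul_nonneg h5 h3]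
  · have h1 : (1 : ℝ) ≤ ‖freq k‖ / (n : ℝ) ^ 2 := by
      rw [one_le_div (by positivity)]
      by_contra hcon
      apply hk
      simp only [hbox, Finset.mem_Icc]
      have h2 : ∀ i, |k i| ≤ (n : ℤ) ^ 2 := by
        intro i
        have := (abs_le_norm_freq k i).trans (not_le.1 hcon).le
        exact_mod_cast this
      exact ⟨fun i => (abs_le.1 (h2 i)).1, fun i => (abs_le.1 (h2 i)).2⟩
    refine (norm_deviation_le (hφB k) a _ hn1 hnV).trans ?_
    unfold devConst
    have h4 : 0 ≤ B * (1 + V) := by positivity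
    have h5 : 0 ≤ Real.sqrt (2 * B ^ 2 * V * (2 * m + 2)) := Real.sqrt_nonneg _
    nlinarith [mul_nonneg h4 hρ, mul_nonneg h5 hρ]

end Deviation

section RandomWeights

variable {α Ω : Type*} [MeasurableSpace α] [MeasurableSpace Ω]

/-- The uniform deviation bound with random weights that are independent of the sample: conditionally
on the weights, the deterministic bound applies. -/
theorem ae_eventually_deviation_le_of_indepFun {m : ℕ} {P : Measure Ω} [IsProbabilityMeasure P]
    {ν : Measure α} [IsProbabilityMeasure ν]
    {X : ℕ → Ω → α} (hX : ∀ j, Measurable (X j)) (hlaw : ∀ j, P.map (X j) = ν)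
    (hind : iIndepFun X P) {φ : (Fin m → ℤ) → α → ℂ} (hφ : ∀ k, Measurable (φ k)) {B : ℝ}
    (hB : 0 < B) (hφB : ∀ k x, ‖φ k x‖ ≤ B) {ε : ℕ → Ω → ℝ} (hε : ∀ j, Measurable (ε j))
    (hXε : IndepFun (fun ω j => X j ω) (fun ω j => ε j ω) P) {V : ℝ} (hV : 0 < V)
    (hεV : ∀ᵐ ω ∂P, ∀ᶠ n : ℕ in atTop, ∑ j ∈ Finset.range n, ε j ω ^ 2 ≤ V * n) :
    ∀ᵐ ω ∂P, ∀ᶠ n : ℕ in atTop, ∀ k,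
      ‖deviation ν (φ k) (fun j => ε j ω) (fun j => X j ω) n‖
        ≤ devConst m B V * (rho n + ‖freq k‖ / (n : ℝ) ^ 2) := by
  set A : Set ((ℕ → ℝ) × (ℕ → α)) := {p |
    (∀ᶠ n : ℕ in atTop, ∑ j ∈ Finset.range n, p.1 j ^ 2 ≤ V * n) →
    ∀ᶠ n : ℕ in atTop, ∀ k, ‖deviation ν (φ k) p.1 p.2 n‖
        ≤ devConst m B V * (rho n + ‖freq k‖ / (n : ℝ) ^ 2)} with hA
  have hdev : ∀ k n, Measurable fun p : (ℕ → ℝ) × (ℕ → α) => deviation ν (φ k) p.1 p.2 n := by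
    intro k n
    unfold deviation
    have h1 : ∀ j : ℕ, Measurable fun p : (ℕ → ℝ) × (ℕ → α) => p.1 j := fun j => by fun_prop
    have h2 : ∀ j : ℕ, Measurable fun p : (ℕ → ℝ) × (ℕ → α) => φ k (p.2 j) := fun j =>
      (hφ k).comp (by fun_prop)
    fun_prop
  have hAm : MeasurableSet A := by
    rw [hA]
    refine measurableSet_setOfPred.2 ?_
    simp only [eventually_atTop]
    refine Measurable.imp ?_ ?_
    · refine Measurable.exists fun N => Measurable.forall fun n => Measurable.imp
        measurable_const ?_
      exact measurableSet_setOfPred.1 (measurableSet_le (by fun_prop) measurable_const)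
    · refine Measurable.exists fun N => Measurable.forall fun n => Measurable.imp
        measurable_const (Measurable.forall fun k => ?_)
      exact measurableSet_setOfPred.1 (measurableSet_le (hdev k n).norm measurable_const)
  have hXm : Measurable fun ω j => X j ω := measurable_pi_lambda _ hX
  have hεm : Measurable fun ω j => ε j ω := measurable_pi_lambda _ hε
  have h1 : ∀ e : ℕ → ℝ, ∀ᵐ x ∂(P.map fun ω j => X j ω), (e, x) ∈ A := by
    intro e
    rw [ae_map_iff hXm.aemeasurable (measurable_prodMk_left hAm)]
    by_cases he : ∀ᶠ n : ℕ in atTop, ∑ j ∈ Finset.range n, e j ^ 2 ≤ V * n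
    · filter_upwards [ae_eventually_deviation_le hX hlaw hind hφ hB hφB e hV he] with ω hω _
      exact hω
    · exact ae_of_all _ fun ω h => absurd h he
  have := Measure.isProbabilityMeasure_map (μ := P) hXm.aemeasurable
  have := Measure.isProbabilityMeasure_map (μ := P) hεm.aemeasurable
  have h2 : ∀ᵐ p ∂((P.map fun ω j => ε j ω).prod (P.map fun ω j => X j ω)), p ∈ A :=
    (Measure.ae_prod_mem_iff_ae_ae_mem hAm).2 (ae_of_all _ h1)
  rw [← (indepFun_iff_map_prod_eq_prod_map_map hεm.aemeasurable hXm.aemeasurable).1 hXε.symm] at h2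
  filter_upwards [ae_of_ae_map (hεm.prodMk hXm).aemeasurable h2, hεV] with ω hω hω'
  exact hω hω'

end RandomWeights

/-! ### Sums of independent centred errors -/

section Errors

variable {Ω : Type*} [MeasurableSpace Ω]

/-- Summation by parts: a bound on the series `∑ x_j / (j+1)^a` controls the partial sums of `x`. -/
lemma abs_sum_le_of_abs_weighted_sum_le {x : ℕ → ℝ} {a C : ℝ} (ha : 0 < a)
    (h : ∀ n, |∑ j ∈ Finset.range n, x j * ((j : ℝ) + 1) ^ (-a)| ≤ C) (n : ℕ) :
    |∑ j ∈ Finset.range n, x j| ≤ 2 * C * (n : ℝ) ^ a := by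
  set T : ℕ → ℝ := fun n => ∑ j ∈ Finset.range n, x j * ((j : ℝ) + 1) ^ (-a) with hT
  have hinc : ∀ j : ℕ, 0 ≤ ((j + 1 : ℕ) : ℝ) ^ a - (j : ℝ) ^ a := fun j =>
    sub_nonneg.2 (Real.rpow_le_rpow (by positivity) (by push_cast; linarith) ha.le)
  have key : ∑ j ∈ Finset.range n, x j =
      (n : ℝ) ^ a * T n - ∑ j ∈ Finset.range n, (((j + 1 : ℕ) : ℝ) ^ a - (j : ℝ) ^ a) * T j := by
    induction n with
    | zero => simp [hT]
    | succ n ih =>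
      rw [Finset.sum_range_succ, Finset.sum_range_succ, ih]
      have h1 : T (n + 1) = T n + x n * ((n : ℝ) + 1) ^ (-a) := Finset.sum_range_succ _ _
      have h2 : ((n + 1 : ℕ) : ℝ) ^ a * ((n : ℝ) + 1) ^ (-a) = 1 := by
        push_cast
        rw [← Real.rpow_add (by positivity)]
        simp
      rw [h1]
      linear_combination (-x n) * h2
  have hsum : ∑ j ∈ Finset.range n, (((j + 1 : ℕ) : ℝ) ^ a - (j : ℝ) ^ a) = (n : ℝ) ^ a := by
    rw [Finset.sum_range_sub (fun j : ℕ => (j : ℝ) ^ a)]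
    simp [Real.zero_rpow ha.ne']
  rw [key]
  calc _ ≤ |(n : ℝ) ^ a * T n| +
        |∑ j ∈ Finset.range n, (((j + 1 : ℕ) : ℝ) ^ a - (j : ℝ) ^ a) * T j| := abs_sub _ _
    _ ≤ (n : ℝ) ^ a * C + ∑ j ∈ Finset.range n, (((j + 1 : ℕ) : ℝ) ^ a - (j : ℝ) ^ a) * C := by
        gcongr
        · rw [abs_mul, abs_of_nonneg (by positivity : 0 ≤ (n : ℝ) ^ a)]
          gcongr
          exact h n
        · refine (Finset.abs_sum_le_sum_abs _ _).trans (Finset.sum_le_sum fun j _ => ?_)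
          rw [abs_mul, abs_of_nonneg (hinc j)]
          exact mul_le_mul_of_nonneg_left (h j) (hinc j)
    _ = 2 * C * (n : ℝ) ^ a := by
        rw [← Finset.sum_mul, hsum]
        ring

/-- For independent centred variables with uniformly bounded variances, the martingale
`∑ ε_j / (j+1)^a`, `a > 1/2`, is bounded in `L²` and hence almost surely bounded. -/
lemma ae_exists_abs_weighted_sum_le {P : Measure Ω} [IsProbabilityMeasure P] {ε : ℕ → Ω → ℝ}
    (hε : ∀ j, Measurable (ε j)) (hind : iIndepFun ε P) (hmean : ∀ j, ∫ ω, ε j ω ∂P = 0)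
    (hL2 : ∀ j, MemLp (ε j) 2 P) {v : ℝ} (hv : ∀ j, ∫ ω, ε j ω ^ 2 ∂P ≤ v)
    {a : ℝ} (ha : 1 / 2 < a) :
    ∀ᵐ ω ∂P, ∃ C : ℝ, ∀ n, |∑ j ∈ Finset.range n, ε j ω * ((j : ℝ) + 1) ^ (-a)| ≤ C := by
  set ξ : ℕ → Ω → ℝ := fun j ω => ε j ω * ((j : ℝ) + 1) ^ (-a) with hξ
  have hξm : ∀ j, Measurable (ξ j) := fun j => (hε j).mul_const _
  have hξind : iIndepFun ξ P := hind.comp (fun j x => x * ((j : ℝ) + 1) ^ (-a))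
    fun j => measurable_id.mul_const _
  have hξL2 : ∀ j, MemLp (ξ j) 2 P := fun j => (hL2 j).mul_const _
  have hξint : ∀ j, Integrable (ξ j) P := fun j => (hξL2 j).integrable (by norm_num)
  have hξmean : ∀ j, ∫ ω, ξ j ω ∂P = 0 := fun j => by
    simp only [hξ]
    rw [integral_mul_const, hmean, zero_mul]
  set ℱ := Filtration.natural ξ fun j => (hξm j).stronglyMeasurable with hℱ
  set M : ℕ → Ω → ℝ := fun n => ∑ j ∈ Finset.range (n + 1), ξ j with hM
  have hMint : ∀ n, Integrable (M n) P := fun n => integrable_finsetSum' _ fun j _ => hξint j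
  have hadp : StronglyAdapted ℱ M := by
    intro n
    refine Finset.stronglyMeasurable_sum _ fun j hj => ?_
    exact (Filtration.stronglyAdapted_natural fun j => (hξm j).stronglyMeasurable) j |>.mono
      (ℱ.mono (Nat.lt_succ_iff.1 (Finset.mem_range.1 hj)))
  have hmart : Martingale M ℱ P := by
    refine martingale_of_condExp_sub_eq_zero_nat hadp hMint fun n => ?_
    have h1 : M (n + 1) - M n = ξ (n + 1) := by
      simp only [hM]
      rw [Finset.sum_range_succ _ (n + 1), add_sub_cancel_left]
    rw [h1]
    refine (hξind.condExp_natural_ae_eq_of_lt (fun j => (hξm j).stronglyMeasurable)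
      (Nat.lt_succ_self n)).trans ?_
    rw [hξmean]
    rfl
  have hsm : Summable fun j : ℕ => v * (((j : ℝ) + 1) ^ (-a)) ^ 2 := by
    refine Summable.mul_left _ ?_
    have h1 : Summable fun j : ℕ => ((j + 1 : ℕ) : ℝ) ^ (-(2 * a)) :=
      (summable_nat_add_iff 1).2 (Real.summable_nat_rpow.2 (by linarith))
    refine h1.congr fun j => ?_
    rw [← Real.rpow_natCast, ← Real.rpow_mul (by positivity)]
    push_cast
    congr 1
    ring
  have hv0 : 0 ≤ v := le_trans (integral_nonneg fun ω => sq_nonneg _) (hv 0)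
  set R : ℝ := ∑' j : ℕ, v * (((j : ℝ) + 1) ^ (-a)) ^ 2 with hR
  have hR0 : 0 ≤ R := tsum_nonneg fun j => by positivity
  have hML2 : ∀ n, MemLp (M n) 2 P := fun n => memLp_finsetSum' _ fun j _ => hξL2 j
  have hM2 : ∀ n, ∫ ω, M n ω ^ 2 ∂P ≤ R := by
    intro n
    have hmean0 : ∫ ω, M n ω ∂P = 0 := by
      simp only [hM, Finset.sum_apply]
      rw [integral_finsetSum _ fun j _ => hξint j]
      simp [hξmean]
    have h1 : variance (M n) P = ∫ ω, M n ω ^ 2 ∂P :=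
      variance_of_integral_eq_zero (hML2 n).1.aemeasurable hmean0
    rw [← h1, hM, IndepFun.variance_sum (fun j _ => hξL2 j)
      fun i _ j _ hij => hξind.indepFun hij]
    refine le_trans (Finset.sum_le_sum fun j _ => ?_) (hsm.sum_le_tsum _ fun j _ => by positivity)
    rw [variance_of_integral_eq_zero (hξm j).aemeasurable (hξmean j)]
    simp only [hξ, mul_pow]
    rw [integral_mul_const]
    gcongr
    exact hv j
  have hbdd : ∀ n, eLpNorm (M n) 1 P ≤ ((1 + R).toNNReal : ENNReal) := by
    intro n
    rw [eLpNorm_one_eq_lintegral_enorm, ← ofReal_integral_norm_eq_lintegral_enorm (hMint n)]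
    refine ENNReal.ofReal_le_ofReal ?_
    have h1 : ∫ ω, ‖M n ω‖ ∂P ≤ ∫ ω, (1 + M n ω ^ 2) ∂P := by
      refine integral_mono (hMint n).norm ((integrable_const 1).add (hML2 n).integrable_sq)
        fun ω => ?_
      simp only [Real.norm_eq_abs]
      rw [← sq_abs]
      nlinarith [sq_nonneg (|M n ω| - 1), abs_nonneg (M n ω)]
    rw [integral_add (integrable_const 1) (hML2 n).integrable_sq] at h1
    simp only [integral_const, probReal_univ, one_smul] at h1
    linarith [hM2 n]
  filter_upwards [hmart.submartingale.ae_tendsto_limitProcess hbdd] with ω hω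
  obtain ⟨C, hC⟩ := hω.norm.bddAbove_range
  refine ⟨max C 0, fun n => ?_⟩
  rcases n with _ | n
  · simp
  · refine le_trans ?_ (le_max_left _ _)
    have := hC ⟨n, rfl⟩
    simpa [hM, hξ] using this

/-- The mean of the errors is almost surely `O(n^{-σ})` for every `σ < 1/2`. -/
lemma ae_exists_abs_mean_le {P : Measure Ω} [IsProbabilityMeasure P] {ε : ℕ → Ω → ℝ}
    (hε : ∀ j, Measurable (ε j)) (hind : iIndepFun ε P) (hmean : ∀ j, ∫ ω, ε j ω ∂P = 0)
    (hL2 : ∀ j, MemLp (ε j) 2 P) {v : ℝ} (hv : ∀ j, ∫ ω, ε j ω ^ 2 ∂P ≤ v)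
    {σ : ℝ} (hσ : σ < 1 / 2) :
    ∀ᵐ ω ∂P, ∃ C : ℝ, 0 ≤ C ∧ ∀ n : ℕ, 1 ≤ n →
      |1 / (n : ℝ) * ∑ j ∈ Finset.range n, ε j ω| ≤ C * (n : ℝ) ^ (-σ) := by
  filter_upwards [ae_exists_abs_weighted_sum_le hε hind hmean hL2 hv (a := 1 - σ)
    (by linarith)] with ω ⟨C, hC⟩
  have hC0 : 0 ≤ C := (abs_nonneg _).trans (hC 0)
  refine ⟨2 * C, by positivity, fun n hn => ?_⟩
  have hn0 : (0 : ℝ) < n := by exact_mod_cast hn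
  have h := abs_sum_le_of_abs_weighted_sum_le (by linarith) hC n
  rw [abs_mul, abs_of_nonneg (by positivity), one_div_mul_eq_div, div_le_iff₀ hn0]
  refine h.trans (le_of_eq ?_)
  rw [sub_eq_neg_add, Real.rpow_add hn0, Real.rpow_one]
  ring

lemma memLp_two_of_integrable_abs_rpow {P : Measure Ω} [IsProbabilityMeasure P] {f : Ω → ℝ}
    (hf : Measurable f) {κ : ℝ} (hκ : 2 < κ) (h : Integrable (fun ω => |f ω| ^ κ) P) :
    MemLp f 2 P := by
  rw [memLp_two_iff_integrable_sq hf.aestronglyMeasurable]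
  refine ((integrable_const (1 : ℝ)).add h).mono' (hf.pow_const 2).aestronglyMeasurable
    (ae_of_all _ fun ω => ?_)
  simp only [Real.norm_eq_abs, abs_pow, sq_abs, Pi.add_apply]
  rw [← sq_abs]
  have h0 : 0 ≤ |f ω| ^ κ := by positivity
  rcases le_total |f ω| 1 with h1 | h1
  · nlinarith [abs_nonneg (f ω)]
  · have := Real.rpow_le_rpow_of_exponent_le h1 hκ.le
    rw [Real.rpow_two] at this
    linarith

/-- The mean squares of identically distributed errors are eventually bounded, by the strong law of
large numbers. -/
lemma ae_eventually_sum_sq_le {P : Measure Ω} [IsProbabilityMeasure P] {ε : ℕ → Ω → ℝ}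
    (hε : ∀ j, Measurable (ε j)) (hind : iIndepFun ε P) (hlaw : ∀ j, P.map (ε j) = P.map (ε 0))
    (hL2 : MemLp (ε 0) 2 P) :
    ∀ᵐ ω ∂P, ∀ᶠ n : ℕ in atTop,
      ∑ j ∈ Finset.range n, ε j ω ^ 2 ≤ (∫ ω, ε 0 ω ^ 2 ∂P + 1) * n := by
  have hid : ∀ j, IdentDistrib (ε j) (ε 0) P P := fun j =>
    ⟨(hε j).aemeasurable, (hε 0).aemeasurable, hlaw j⟩
  have h := strong_law_ae_real (fun j ω => ε j ω ^ 2) hL2.integrable_sq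
    (fun i j hij => (hind.indepFun hij).comp (φ := fun x => x ^ 2) (ψ := fun x => x ^ 2)
      (by fun_prop) (by fun_prop))
    (fun j => (hid j).comp (u := fun x => x ^ 2) (by fun_prop))
  filter_upwards [h] with ω hω
  filter_upwards [hω.eventually (gt_mem_nhds (lt_add_one _)), eventually_ge_atTop 1] with n hn hn1
  have hn0 : (0 : ℝ) < n := by exact_mod_cast hn1
  exact ((div_lt_iff₀ hn0).1 hn).le

end Errors

/-! ### Smoothed empirical Fourier series -/

section Smoothing

variable {m : ℕ} {Λ : EuclideanSpace ℝ (Fin m) → ℂ} {c p Q : ℝ}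

/-- `Q` bounds the sum of the sampled kernel `Λ(c k)`, weighted by `1 + ‖c k‖^p`. -/
def KernelBound (Λ : EuclideanSpace ℝ (Fin m) → ℂ) (c p Q : ℝ) : Prop :=
  (Summable fun k : Fin m → ℤ => (1 + ‖c • freq k‖ ^ p) * ‖Λ (c • freq k)‖) ∧
    ∑' k : Fin m → ℤ, (1 + ‖c • freq k‖ ^ p) * ‖Λ (c • freq k)‖ ≤ Q

lemma KernelBound.nonneg (hQ : KernelBound Λ c p Q) : 0 ≤ Q :=
  (tsum_nonneg fun k => by positivity).trans hQ.2

lemma KernelBound.summable (hQ : KernelBound Λ c p Q) :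
    Summable fun k : Fin m → ℤ => ‖Λ (c • freq k)‖ := by
  refine hQ.1.of_nonneg_of_le (fun k => norm_nonneg _) fun k => ?_
  refine le_mul_of_one_le_left (norm_nonneg _) ?_
  have : 0 ≤ ‖c • freq k‖ ^ p := by positivity
  linarith

lemma norm_freq_le_inv_mul (hc : 0 < c) (hp : 1 ≤ p) (k : Fin m → ℤ) :
    ‖freq k‖ ≤ c⁻¹ * (1 + ‖c • freq k‖ ^ p) := by
  have h1 : ‖freq k‖ = c⁻¹ * ‖c • freq k‖ := by
    rw [norm_smul, Real.norm_eq_abs, abs_of_pos hc]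
    field_simp
  rw [h1]
  gcongr
  rcases le_total ‖c • freq k‖ 1 with h | h
  · have : 0 ≤ ‖c • freq k‖ ^ p := by positivity
    linarith
  · have := Real.self_le_rpow_of_one_le h hp
    linarith

/-- A sequence of at most linear growth, summed against the sampled kernel. -/
lemma KernelBound.tsum_le (hQ : KernelBound Λ c p Q) (hc : 0 < c) (hp : 1 ≤ p)
    {A T : ℝ} (hA : 0 ≤ A) (hT : 0 ≤ T) {d : (Fin m → ℤ) → ℂ}
    (hd : ∀ k, ‖d k‖ ≤ A + T * ‖freq k‖) :
    (Summable fun k => ‖Λ (c • freq k)‖ * ‖d k‖) ∧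
      ∑' k, ‖Λ (c • freq k)‖ * ‖d k‖ ≤ (A + T * c⁻¹) * Q := by
  have hle : ∀ k, ‖Λ (c • freq k)‖ * ‖d k‖ ≤
      (A + T * c⁻¹) * ((1 + ‖c • freq k‖ ^ p) * ‖Λ (c • freq k)‖) := by
    intro k
    have h0 : 0 ≤ ‖c • freq k‖ ^ p := by positivity
    have h1 : ‖d k‖ ≤ (A + T * c⁻¹) * (1 + ‖c • freq k‖ ^ p) := by
      calc ‖d k‖ ≤ A + T * ‖freq k‖ := hd k
        _ ≤ A * (1 + ‖c • freq k‖ ^ p) + T * (c⁻¹ * (1 + ‖c • freq k‖ ^ p)) := by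
            gcongr
            · nlinarith
            · exact norm_freq_le_inv_mul hc hp k
        _ = _ := by ring
    calc _ ≤ ‖Λ (c • freq k)‖ * ((A + T * c⁻¹) * (1 + ‖c • freq k‖ ^ p)) := by gcongr
      _ = _ := by ring
  have hs := (hQ.1.mul_left (A + T * c⁻¹)).of_nonneg_of_le (fun k => by positivity) hle
  refine ⟨hs, (hs.tsum_le_tsum hle (hQ.1.mul_left _)).trans ?_⟩
  rw [tsum_mul_left]
  have : 0 ≤ A + T * c⁻¹ := by positivity
  gcongr
  exact hQ.2

/-- Smoothing bias: only the frequencies with `‖c k‖ > 1` contribute. -/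
lemma IsSmoothingKernel.bias_le (hΛ : IsSmoothingKernel Λ) (hc : 0 < c) {t : ℝ} (ht : 0 < t)
    {a : (Fin m → ℤ) → ℂ} (ha : Summable fun k => ‖freq k‖ ^ t * ‖a k‖) :
    (Summable fun k => ‖Λ (c • freq k) * a k - a k‖) ∧
      ∑' k, ‖Λ (c • freq k) * a k - a k‖ ≤ 2 * c ^ t * ∑' k, ‖freq k‖ ^ t * ‖a k‖ := by
  have hle : ∀ k, ‖Λ (c • freq k) * a k - a k‖ ≤ 2 * c ^ t * (‖freq k‖ ^ t * ‖a k‖) := by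
    intro k
    by_cases hk : ‖c • freq k‖ ≤ 1
    · rw [hΛ.eq_one _ hk, one_mul, sub_self, norm_zero]
      positivity
    · have h1 : ‖c • freq k‖ = c * ‖freq k‖ := by
        rw [norm_smul, Real.norm_eq_abs, abs_of_pos hc]
      have h2 : 1 ≤ c ^ t * ‖freq k‖ ^ t := by
        rw [← Real.mul_rpow hc.le (norm_nonneg _), ← h1]
        exact Real.one_le_rpow (not_le.1 hk).le ht.le
      have h3 : ‖Λ (c • freq k) * a k - a k‖ ≤ 2 * ‖a k‖ := by
        refine (norm_sub_le _ _).trans ?_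
        rw [norm_mul]
        nlinarith [hΛ.norm_le (c • freq k), norm_nonneg (a k)]
      calc _ ≤ 2 * ‖a k‖ := h3
        _ ≤ (c ^ t * ‖freq k‖ ^ t) * (2 * ‖a k‖) := le_mul_of_one_le_left (by positivity) h2
        _ = _ := by ring
  have hs := (ha.mul_left (2 * c ^ t)).of_nonneg_of_le (fun k => norm_nonneg _) hle
  refine ⟨hs, (hs.tsum_le_tsum hle (ha.mul_left _)).trans ?_⟩
  rw [tsum_mul_left]

/-- The empirical Fourier coefficients of the weighted sample `(x_j, w_j)`. -/
noncomputable def empCoef (n : ℕ) (x : ℕ → Fin m → ℝ) (w : ℕ → ℂ) (k : Fin m → ℤ) : ℂ :=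
  (1 / (n : ℂ)) * ∑ j ∈ Finset.range n, w j * expi (-k) (x j)

lemma norm_empCoef_le (n : ℕ) (x : ℕ → Fin m → ℝ) (w : ℕ → ℂ) (k : Fin m → ℤ) :
    ‖empCoef n x w k‖ ≤ 1 / (n : ℝ) * ∑ j ∈ Finset.range n, ‖w j‖ := by
  unfold empCoef
  rw [norm_mul, norm_div, norm_one, Complex.norm_natCast]
  gcongr
  refine norm_sum_le_of_le _ fun j _ => ?_
  rw [norm_mul, norm_expi, mul_one]

/-- Convolving a weighted empirical measure with the kernel multiplies its Fourier coefficients by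
`Λ(c k)`. -/
lemma sum_mul_weight_eq (hsum : Summable fun k : Fin m → ℤ => ‖Λ (c • freq k)‖) (n : ℕ)
    (x : ℕ → Fin m → ℝ) (w : ℕ → ℂ) (y : Fin m → ℝ) :
    (1 / (n : ℂ)) * ∑ j ∈ Finset.range n, w j * weight Λ c (y - x j) =
      ∑' k, Λ (c • freq k) * empCoef n x w k * expi k y := by
  have h1 : ∀ j, w j * weight Λ c (y - x j) =
      ∑' k, Λ (c • freq k) * (w j * expi (-k) (x j)) * expi k y := by
    intro j
    unfold weight
    rw [← tsum_mul_left]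
    refine tsum_congr fun k => ?_
    rw [expi_sub_right]
    ring
  have hs : ∀ j ∈ Finset.range n,
      Summable fun k => Λ (c • freq k) * (w j * expi (-k) (x j)) * expi k y := by
    intro j _
    refine Summable.of_norm ?_
    simp only [norm_mul, norm_expi, mul_one]
    exact hsum.mul_right _
  simp only [h1]
  rw [← Summable.tsum_finsetSum hs, ← tsum_mul_left]
  refine tsum_congr fun k => ?_
  unfold empCoef
  rw [← Finset.sum_mul, ← Finset.mul_sum]
  ring

/-- A smoothed trigonometric series with perturbed coefficients: stochastic part plus bias. -/
lemma norm_tsum_sub_tsum_le (hΛ : IsSmoothingKernel Λ) (hQ : KernelBound Λ c p Q) (hc : 0 < c)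
    (hp : 1 ≤ p) {A T : ℝ} (hA : 0 ≤ A) (hT : 0 ≤ T) {R a : (Fin m → ℤ) → ℂ}
    (hd : ∀ k, ‖R k - a k‖ ≤ A + T * ‖freq k‖) {t : ℝ} (ht : 0 < t)
    (ha : Summable fun k => ‖freq k‖ ^ t * ‖a k‖) (y : Fin m → ℝ) :
    ‖∑' k, Λ (c • freq k) * R k * expi k y - ∑' k, a k * expi k y‖ ≤
      (A + T * c⁻¹) * Q + 2 * c ^ t * ∑' k, ‖freq k‖ ^ t * ‖a k‖ := by
  obtain ⟨h1, h2⟩ := hQ.tsum_le hc hp hA hT hd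
  obtain ⟨h3, h4⟩ := hΛ.bias_le hc ht ha
  have h1' : Summable fun k => ‖Λ (c • freq k) * (R k - a k)‖ := by
    simpa only [norm_mul] using h1
  have h2' : ∑' k, ‖Λ (c • freq k) * (R k - a k)‖ ≤ (A + T * c⁻¹) * Q := by
    simpa only [norm_mul] using h2
  have ha' := summable_of_summable_rpow ht (fun k => norm_nonneg (a k)) ha
  have e : ∑' k, Λ (c • freq k) * R k * expi k y = ∑' k, Λ (c • freq k) * (R k - a k) * expi k y +
      ∑' k, (Λ (c • freq k) * a k - a k) * expi k y + ∑' k, a k * expi k y := by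
    rw [← (summable_mul_expi h1' y).tsum_add (summable_mul_expi h3 y),
      ← ((summable_mul_expi h1' y).add (summable_mul_expi h3 y)).tsum_add
        (summable_mul_expi ha' y)]
    refine tsum_congr fun k => ?_
    ring
  rw [e, add_sub_cancel_right]
  refine (norm_add_le _ _).trans (add_le_add ?_ ?_)
  · exact (norm_tsum_expi_le h1' y).trans h2'
  · exact (norm_tsum_expi_le h3 y).trans h4

/-- The empirical second moment of the kernel is of the order `Q` of the integral of `|W_c|²`. The
weights `v_j` are normalized so that the weighted sample approximates the uniform distribution. -/
lemma sum_mul_norm_weight_sq_le (hΛ : IsSmoothingKernel Λ) (hQ : KernelBound Λ c p Q) (hc : 0 < c)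
    (hp : 1 ≤ p) {A T : ℝ} (hA : 0 ≤ A) (hT : 0 ≤ T) {n : ℕ} {x : ℕ → Fin m → ℝ} {v : ℕ → ℝ}
    (hd : ∀ k, ‖empCoef n x (fun j => (v j : ℂ)) k - if k = 0 then 1 else 0‖
      ≤ A + T * ‖freq k‖) (y : Fin m → ℝ) :
    1 / (n : ℝ) * ∑ j ∈ Finset.range n, v j * ‖weight Λ c (y - x j)‖ ^ 2 ≤
      Q + 2 * (A + T * c⁻¹) * Q ^ 2 := by
  have hQ0 := hQ.nonneg
  set F := empCoef n x (fun j => (v j : ℂ)) with hF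
  have hinner : ∀ k, ‖empCoef n x (fun j => (v j : ℂ) * star (weight Λ c (y - x j))) k‖ ≤
      (1 + (A + T * c⁻¹) * Q) + T * Q * ‖freq k‖ := by
    intro k
    have h1 : star (empCoef n x (fun j => (v j : ℂ) * star (weight Λ c (y - x j))) k) =
        ∑' l, Λ (c • freq l) * empCoef n x (fun j => (v j : ℂ) * expi k (x j)) l * expi l y := by
      rw [← sum_mul_weight_eq hQ.summable]
      unfold empCoef
      rw [star_mul, star_sum, mul_comm]
      congr 1
      · simp
      · refine Finset.sum_congr rfl fun j _ => ?_
        rw [star_mul, star_mul, star_star, star_expi, neg_neg]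
        simp
        ring
    have h2 : ∀ l, empCoef n x (fun j => (v j : ℂ) * expi k (x j)) l = F (l - k) := by
      intro l
      simp only [hF, empCoef]
      congr 1
      refine Finset.sum_congr rfl fun j _ => ?_
      rw [mul_assoc, ← expi_add]
      congr 2
      abel
    have hkk : ∀ l, ‖F (l - k) - if l = k then 1 else 0‖ ≤
        (A + T * ‖freq k‖) + T * ‖freq l‖ := by
      intro l
      have := hd (l - k)
      simp only [sub_eq_zero] at this
      refine this.trans ?_
      rw [freq_sub]
      have := norm_sub_le (freq l) (freq k)
      nlinarith
    obtain ⟨h3, h4⟩ := hQ.tsum_le hc hp (by positivity) hT hkk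
    have h3' : Summable fun l => ‖Λ (c • freq l) * (F (l - k) - if l = k then 1 else 0)‖ := by
      simpa only [norm_mul] using h3
    have h5 : HasSum (fun l => Λ (c • freq l) * (if l = k then 1 else 0) * expi l y)
        (Λ (c • freq k) * expi k y) := by
      convert! hasSum_ite_eq k (Λ (c • freq k) * expi k y) using 2 with l
      split_ifs with h
      · rw [h, mul_one]
      · simp
    have e : ∑' l, Λ (c • freq l) * F (l - k) * expi l y =
        ∑' l, Λ (c • freq l) * (F (l - k) - if l = k then 1 else 0) * expi l y +
          Λ (c • freq k) * expi k y := by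
      rw [← h5.tsum_eq, ← (summable_mul_expi h3' y).tsum_add h5.summable]
      refine tsum_congr fun l => ?_
      ring
    rw [← norm_star, h1]
    simp only [h2]
    rw [e]
    refine (norm_add_le _ _).trans ?_
    have h6 := norm_tsum_expi_le h3' y
    simp only [norm_mul] at h6
    rw [norm_mul, norm_expi, mul_one]
    have h7 := hΛ.norm_le (c • freq k)
    calc _ ≤ (A + T * ‖freq k‖ + T * c⁻¹) * Q + 1 := by
          gcongr
          exact h6.trans h4
      _ = _ := by ring
  obtain ⟨h8, h9⟩ := hQ.tsum_le hc hp (by positivity) (by positivity) hinner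
  have h10 : ((1 / (n : ℝ) * ∑ j ∈ Finset.range n, v j * ‖weight Λ c (y - x j)‖ ^ 2 : ℝ) : ℂ) =
      ∑' k, Λ (c • freq k) *
        empCoef n x (fun j => (v j : ℂ) * star (weight Λ c (y - x j))) k * expi k y := by
    rw [← sum_mul_weight_eq hQ.summable]
    push_cast
    congr 1
    refine Finset.sum_congr rfl fun j _ => ?_
    rw [mul_assoc, mul_comm (star _)]
    congr 1
    exact (RCLike.mul_conj (weight Λ c (y - x j))).symm
  have h8' : Summable fun k => ‖Λ (c • freq k) *
      empCoef n x (fun j => (v j : ℂ) * star (weight Λ c (y - x j))) k‖ := by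
    simpa only [norm_mul] using h8
  have h11 := norm_tsum_expi_le h8' y
  rw [← h10, Complex.norm_real] at h11
  simp only [norm_mul (Λ _)] at h11
  refine (Real.le_norm_self _).trans ((h11.trans h9).trans ?_)
  have : 0 ≤ A * Q ^ 2 := by positivity
  nlinarith

end Smoothing

/-! ### Error bounds for a fixed sample -/

section FixedSample

variable {m : ℕ} {Λ : EuclideanSpace ℝ (Fin m) → ℂ} {c p Q A T : ℝ} {n : ℕ} {x : ℕ → Fin m → ℝ}

lemma norm_densityEst_sub_le (hΛ : IsSmoothingKernel Λ) (hQ : KernelBound Λ c p Q) (hc : 0 < c)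
    (hp : 1 ≤ p) (hA : 0 ≤ A) (hT : 0 ≤ T) {γ : (Fin m → ℤ) → ℂ}
    (hd : ∀ k, ‖empCoef n x (fun _ => 1) k - γ k‖ ≤ A + T * ‖freq k‖) {t : ℝ} (ht : 0 < t)
    (hγ : Summable fun k => ‖freq k‖ ^ t * ‖γ k‖) (y : Fin m → ℝ) :
    ‖densityEst Λ c n x y - ∑' k, γ k * expi k y‖ ≤
      (A + T * c⁻¹) * Q + 2 * c ^ t * ∑' k, ‖freq k‖ ^ t * ‖γ k‖ := by
  have h : densityEst Λ c n x y = ∑' k, Λ (c • freq k) * empCoef n x (fun _ => 1) k * expi k y := by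
    rw [← sum_mul_weight_eq hQ.summable]
    simp [densityEst]
  rw [h]
  exact norm_tsum_sub_tsum_le hΛ hQ hc hp hA hT hd ht hγ y

lemma norm_inv_sub_inv_le {z : ℂ} {h δ η : ℝ} (hδ : 0 < δ) (hh : δ ≤ h) (hz : ‖z - h‖ ≤ η)
    (hη : η ≤ δ / 2) : z ≠ 0 ∧ ‖z⁻¹ - (h : ℂ)⁻¹‖ ≤ 2 / δ ^ 2 * η := by
  have hh0 : 0 < h := hδ.trans_le hh
  have hhn : ‖(h : ℂ)‖ = h := by rw [Complex.norm_real, Real.norm_eq_abs, abs_of_pos hh0]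
  have hz2 : δ / 2 ≤ ‖z‖ := by
    have := norm_sub_norm_le (h : ℂ) z
    rw [norm_sub_rev, hhn] at this
    linarith
  have hz0 : z ≠ 0 := by
    rw [← norm_pos_iff]
    linarith
  refine ⟨hz0, ?_⟩
  have hh0' : (h : ℂ) ≠ 0 := by exact_mod_cast hh0.ne'
  have hη0 : 0 ≤ η := (norm_nonneg _).trans hz
  rw [inv_sub_inv hz0 hh0', norm_div, norm_mul, norm_sub_rev, hhn]
  calc _ ≤ η / (δ / 2 * δ) := by gcongr
    _ = _ := by field_simp

/-- Perturbation of the weights of a smoothed empirical measure. By the Cauchy–Schwarz inequality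
the price is the square root of the second moment of the kernel, which is of smaller order than its
supremum. -/
lemma norm_sum_mul_weight_le {Y : ℕ → ℝ} {D : ℕ → ℂ} {κ VY W : ℝ} (hκ : 0 ≤ κ)
    (hD : ∀ j < n, ‖D j‖ ≤ κ) (hY : 1 / (n : ℝ) * ∑ j ∈ Finset.range n, Y j ^ 2 ≤ VY)
    {y : Fin m → ℝ} (hW : 1 / (n : ℝ) * ∑ j ∈ Finset.range n, ‖weight Λ c (y - x j)‖ ^ 2 ≤ W) :
    ‖(1 / (n : ℂ)) * ∑ j ∈ Finset.range n, (Y j : ℂ) * D j * weight Λ c (y - x j)‖ ≤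
      κ * Real.sqrt (VY * W) := by
  have h1 : ‖∑ j ∈ Finset.range n, (Y j : ℂ) * D j * weight Λ c (y - x j)‖ ≤
      κ * ∑ j ∈ Finset.range n, |Y j| * ‖weight Λ c (y - x j)‖ := by
    rw [Finset.mul_sum]
    refine norm_sum_le_of_le _ fun j hj => ?_
    rw [norm_mul, norm_mul, Complex.norm_real, Real.norm_eq_abs]
    have := hD j (Finset.mem_range.1 hj)
    calc _ ≤ |Y j| * κ * ‖weight Λ c (y - x j)‖ := by gcongr
      _ = _ := by ring
  have h2 : 1 / (n : ℝ) * ∑ j ∈ Finset.range n, |Y j| * ‖weight Λ c (y - x j)‖ ≤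
      Real.sqrt (VY * W) := by
    refine Real.le_sqrt_of_sq_le ?_
    have h3 := Finset.sum_mul_sq_le_sq_mul_sq (Finset.range n) (fun j => |Y j|)
      (fun j => ‖weight Λ c (y - x j)‖)
    simp only [sq_abs] at h3
    have h4 : 0 ≤ 1 / (n : ℝ) * ∑ j ∈ Finset.range n, ‖weight Λ c (y - x j)‖ ^ 2 := by positivity
    have h5 : 0 ≤ 1 / (n : ℝ) * ∑ j ∈ Finset.range n, Y j ^ 2 := by positivity
    calc _ = (1 / (n : ℝ)) ^ 2 *
          (∑ j ∈ Finset.range n, |Y j| * ‖weight Λ c (y - x j)‖) ^ 2 := by ring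
      _ ≤ (1 / (n : ℝ)) ^ 2 * ((∑ j ∈ Finset.range n, Y j ^ 2) *
          ∑ j ∈ Finset.range n, ‖weight Λ c (y - x j)‖ ^ 2) := by gcongr
      _ = (1 / (n : ℝ) * ∑ j ∈ Finset.range n, Y j ^ 2) *
          (1 / (n : ℝ) * ∑ j ∈ Finset.range n, ‖weight Λ c (y - x j)‖ ^ 2) := by ring
      _ ≤ VY * W := mul_le_mul hY hW h4 (h5.trans hY)
  rw [norm_mul, norm_div, norm_one, Complex.norm_natCast]
  calc _ ≤ 1 / (n : ℝ) * (κ * ∑ j ∈ Finset.range n, |Y j| * ‖weight Λ c (y - x j)‖) := by gcongr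
    _ = κ * (1 / (n : ℝ) * ∑ j ∈ Finset.range n, |Y j| * ‖weight Λ c (y - x j)‖) := by ring
    _ ≤ _ := by gcongr

lemma coefEst_eq_empCoef (Y : ℕ → ℝ) (k : Fin m → ℤ) :
    coefEst Λ c n x Y k = empCoef n x (fun j => (Y j : ℂ) / densityEst Λ c n x (x j)) k := rfl

/-- Uniform error bound for the regression estimator. The terms on the right are, in this order: the
fluctuations of the signal and noise parts, the smoothing bias, the mean of the errors (the zero
frequency of the noise part) and the effect of the estimated density. -/
lemma norm_regressionEst_sub_le (hΛ : IsSmoothingKernel Λ) (hQ : KernelBound Λ c p Q) (hc : 0 < c)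
    (hp : 1 ≤ p) (hA : 0 ≤ A) (hT : 0 ≤ T) {h r e : ℕ → ℝ} {δ B η VY : ℝ} (hδ : 0 < δ)
    (hh : ∀ j, δ ≤ h j) (hhB : ∀ j, h j ≤ B)
    (hη : ∀ j < n, ‖densityEst Λ c n x (x j) - h j‖ ≤ η) (hη0 : 0 ≤ η) (hηδ : η ≤ δ / 2)
    (hunif : ∀ k, ‖empCoef n x (fun j => ((h j)⁻¹ : ℝ)) k - if k = 0 then 1 else 0‖
      ≤ A + T * ‖freq k‖)
    {ζ : (Fin m → ℤ) → ℂ}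
    (hsig : ∀ k, ‖empCoef n x (fun j => (r j * (h j)⁻¹ : ℝ)) k - ζ k‖ ≤ A + T * ‖freq k‖)
    {ebar : ℝ}
    (hnoise : ∀ k, ‖empCoef n x (fun j => (e j * (h j)⁻¹ : ℝ)) k
      - if k = 0 then (ebar : ℂ) else 0‖ ≤ A + T * ‖freq k‖)
    (hY : 1 / (n : ℝ) * ∑ j ∈ Finset.range n, (r j + e j) ^ 2 ≤ VY)
    {t : ℝ} (ht : 0 < t) (hζ : Summable fun k => ‖freq k‖ ^ t * ‖ζ k‖) (y : Fin m → ℝ) :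
    ‖regressionEst Λ c n x (fun j => r j + e j) y - ∑' k, ζ k * expi k y‖ ≤
      2 * (A + T * c⁻¹) * Q + 2 * c ^ t * ∑' k, ‖freq k‖ ^ t * ‖ζ k‖ + |ebar| +
        2 / δ ^ 2 * η * Real.sqrt (VY * (B * (Q + 2 * (A + T * c⁻¹) * Q ^ 2))) := by
  set D : ℕ → ℂ := fun j => (densityEst Λ c n x (x j))⁻¹ - ((h j : ℝ) : ℂ)⁻¹ with hD
  set a : (Fin m → ℤ) → ℂ := fun k => ζ k + if k = 0 then (ebar : ℂ) else 0 with ha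
  set R : (Fin m → ℤ) → ℂ := fun k => empCoef n x (fun j => (r j * (h j)⁻¹ : ℝ)) k +
    empCoef n x (fun j => (e j * (h j)⁻¹ : ℝ)) k with hR
  have hζ' := summable_of_summable_rpow ht (fun k => norm_nonneg (ζ k)) hζ
  -- the zero frequency does not enter the smoothing bias
  have hak : ∀ k, ‖freq k‖ ^ t * ‖a k‖ = ‖freq k‖ ^ t * ‖ζ k‖ := by
    intro k
    rcases eq_or_ne k 0 with rfl | hk
    · simp [Real.zero_rpow ht.ne']
    · simp [ha, hk]
  have hRa : ∀ k, ‖R k - a k‖ ≤ 2 * A + (2 * T) * ‖freq k‖ := by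
    intro k
    have e1 : R k - a k = (empCoef n x (fun j => (r j * (h j)⁻¹ : ℝ)) k - ζ k) +
        (empCoef n x (fun j => (e j * (h j)⁻¹ : ℝ)) k - if k = 0 then (ebar : ℂ) else 0) := by
      simp only [hR, ha]
      ring
    rw [e1]
    refine (norm_add_le _ _).trans ?_
    linarith [hsig k, hnoise k]
  have h1 := norm_tsum_sub_tsum_le hΛ hQ hc hp (by positivity) (by positivity) hRa ht
    (by simpa only [hak] using hζ) y
  simp only [hak] at h1
  have h2 : ∑' k, a k * expi k y = ∑' k, ζ k * expi k y + ebar := by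
    have h3 : HasSum (fun k => (if k = 0 then (ebar : ℂ) else 0) * expi k y) (ebar : ℂ) := by
      convert! hasSum_ite_eq (0 : Fin m → ℤ) (ebar : ℂ) using 2 with k
      split_ifs with hk
      · rw [hk, expi_zero, mul_one]
      · simp
    rw [← h3.tsum_eq, ← (summable_mul_expi hζ' y).tsum_add h3.summable]
    refine tsum_congr fun k => ?_
    simp only [ha]
    ring
  have h4 : regressionEst Λ c n x (fun j => r j + e j) y = ∑' k, Λ (c • freq k) * R k * expi k y +
      (1 / (n : ℂ)) * ∑ j ∈ Finset.range n,
        ((r j + e j : ℝ) : ℂ) * D j * weight Λ c (y - x j) := by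
    have hR' : ∀ k, R k = empCoef n x (fun j => ((r j + e j : ℝ) : ℂ) * ((h j : ℝ) : ℂ)⁻¹) k := by
      intro k
      simp only [hR, empCoef, ← mul_add, ← Finset.sum_add_distrib]
      congr 1
      refine Finset.sum_congr rfl fun j _ => ?_
      push_cast
      ring
    have h5 : regressionEst Λ c n x (fun j => r j + e j) y =
        (1 / (n : ℂ)) * ∑ j ∈ Finset.range n,
          (((r j + e j : ℝ) : ℂ) / densityEst Λ c n x (x j)) * weight Λ c (y - x j) := by
      rw [sum_mul_weight_eq hQ.summable]
      rfl
    rw [h5]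
    simp only [hR']
    rw [← sum_mul_weight_eq hQ.summable, ← mul_add, ← Finset.sum_add_distrib]
    congr 1
    refine Finset.sum_congr rfl fun j _ => ?_
    simp only [hD]
    ring
  have hDb : ∀ j < n, ‖D j‖ ≤ 2 / δ ^ 2 * η := fun j hj =>
    (norm_inv_sub_inv_le hδ (hh j) (hη j hj) hηδ).2
  have hW0 := sum_mul_norm_weight_sq_le hΛ hQ hc hp hA hT hunif y
  have hB : 0 < B := hδ.trans_le ((hh 0).trans (hhB 0))
  have hW : 1 / (n : ℝ) * ∑ j ∈ Finset.range n, ‖weight Λ c (y - x j)‖ ^ 2 ≤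
      B * (Q + 2 * (A + T * c⁻¹) * Q ^ 2) := by
    refine le_trans ?_ (mul_le_mul_of_nonneg_left hW0 hB.le)
    rw [← mul_assoc, mul_comm B, mul_assoc, Finset.mul_sum _ _ B]
    gcongr with j _
    rw [← mul_assoc]
    refine le_mul_of_one_le_left (by positivity) ?_
    rw [← div_eq_mul_inv, one_le_div (hδ.trans_le (hh j))]
    exact hhB j
  have h6 := norm_sum_mul_weight_le (Λ := Λ) (c := c) (x := x) (y := y) (by positivity) hDb hY hW
  rw [h2] at h1
  rw [h4]
  have e2 : ∑' k, Λ (c • freq k) * R k * expi k y + (1 / (n : ℂ)) * ∑ j ∈ Finset.range n,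
      ((r j + e j : ℝ) : ℂ) * D j * weight Λ c (y - x j) - ∑' k, ζ k * expi k y =
      (∑' k, Λ (c • freq k) * R k * expi k y - (∑' k, ζ k * expi k y + ebar)) + ebar +
      (1 / (n : ℂ)) * ∑ j ∈ Finset.range n,
        ((r j + e j : ℝ) : ℂ) * D j * weight Λ c (y - x j) := by ring
  rw [e2]
  refine (norm_add₃_le).trans (add_le_add (add_le_add (h1.trans (le_of_eq ?_)) ?_) h6)
  · ring
  · rw [Complex.norm_real, Real.norm_eq_abs]

/-- Every realization of the estimation error belongs to the space `M(s)`. -/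
lemma regressionEst_sub_mem_MSpace {s : ℝ} (hs : 0 < s) (hsp : s ≤ p)
    (hQ : KernelBound Λ c p Q) (hc : 0 < c) (Y : ℕ → ℝ) {ζ : (Fin m → ℤ) → ℂ}
    (hζ : Summable fun k => ‖freq k‖ ^ s * ‖ζ k‖) :
    (fun y => regressionEst Λ c n x Y y - ∑' k, ζ k * expi k y) ∈ MSpace m s := by
  set w : ℕ → ℂ := fun j => (Y j : ℂ) / densityEst Λ c n x (x j) with hw
  set b : (Fin m → ℤ) → ℂ := fun k => Λ (c • freq k) * coefEst Λ c n x Y k with hb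
  set K : ℝ := 1 / (n : ℝ) * ∑ j ∈ Finset.range n, ‖w j‖ with hK
  have hK0 : 0 ≤ K := by positivity
  have hbs : Summable fun k => ‖freq k‖ ^ s * ‖b k‖ := by
    refine (hQ.1.mul_left ((c⁻¹) ^ s * K)).of_nonneg_of_le (fun k => by positivity) fun k => ?_
    have h1 : ‖freq k‖ ^ s ≤ (c⁻¹) ^ s * (1 + ‖c • freq k‖ ^ p) := by
      have h2 : ‖freq k‖ = c⁻¹ * ‖c • freq k‖ := by
        rw [norm_smul, Real.norm_eq_abs, abs_of_pos hc]
        field_simp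
      rw [h2, Real.mul_rpow (by positivity) (norm_nonneg _)]
      gcongr
      have h3 : 0 ≤ ‖c • freq k‖ ^ p := by positivity
      rcases le_total ‖c • freq k‖ 1 with h | h
      · linarith [Real.rpow_le_one (norm_nonneg _) h hs.le]
      · linarith [Real.rpow_le_rpow_of_exponent_le h hsp]
    have h4 : ‖b k‖ ≤ ‖Λ (c • freq k)‖ * K := by
      simp only [hb, norm_mul]
      gcongr
      rw [coefEst_eq_empCoef]
      exact norm_empCoef_le n x w k
    calc _ ≤ (c⁻¹) ^ s * (1 + ‖c • freq k‖ ^ p) * (‖Λ (c • freq k)‖ * K) := by gcongr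
      _ = _ := by ring
  have hb1 := summable_of_summable_rpow hs (fun k => norm_nonneg (b k)) hbs
  have hζ1 := summable_of_summable_rpow hs (fun k => norm_nonneg (ζ k)) hζ
  have e : (fun y => regressionEst Λ c n x Y y - ∑' k, ζ k * expi k y) =
      fun y => ∑' k, (b k - ζ k) * expi k y := by
    funext y
    have : regressionEst Λ c n x Y y = ∑' k, b k * expi k y := rfl
    rw [this, ← (summable_mul_expi hb1 y).tsum_sub (summable_mul_expi hζ1 y)]
    refine tsum_congr fun k => ?_
    ring
  rw [e]
  refine tsum_mem_MSpace hs ((hbs.add hζ).of_nonneg_of_le (fun k => by positivity) fun k => ?_)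
  rw [← mul_add]
  gcongr
  exact norm_sub_le _ _

end FixedSample

/-! ### Balancing the rates -/

section Rates

lemma logRate_eq_rpow (α : ℝ) {n : ℕ} (hn : 1 ≤ n) :
    logRate α n = (Real.log n / n) ^ α := by
  have hn' : (1 : ℝ) ≤ n := by exact_mod_cast hn
  rw [logRate, Real.div_rpow (Real.log_nonneg hn') (by positivity), Real.rpow_neg (by positivity)]
  ring

lemma tendsto_log_div_self : Tendsto (fun n : ℕ => Real.log n / (n : ℝ)) atTop (𝓝 0) :=
  Real.isLittleO_log_id_atTop.tendsto_div_nhds_zero.comp tendsto_natCast_atTop_atTop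

lemma tendsto_logRate {α : ℝ} (hα : 0 < α) : Tendsto (logRate α) atTop (𝓝 0) := by
  have h := tendsto_log_div_self.rpow_const (p := α) (Or.inr hα.le)
  rw [Real.zero_rpow hα.ne'] at h
  refine h.congr' ?_
  filter_upwards [eventually_ge_atTop 1] with n hn
  rw [logRate_eq_rpow α hn]

/-- In terms of `u = (log n / n)^{1/N}` with `N = 2s + 3m`, the fluctuation rate is
`u^{s + 3m/2}`, the target rate is `u^s`, and the remainders that are powers of `n` alone are
dominated by these. -/
lemma eventually_rates {m : ℕ} (hm : 1 ≤ m) {s : ℝ} (hs : 0 < s) :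
    ∀ᶠ n : ℕ in atTop, 0 < logRate (1 / (2 * s + 3 * m)) n ∧
      logRate (1 / (2 * s + 3 * m)) n ≤ 1 ∧
      rho n = logRate (1 / (2 * s + 3 * m)) n ^ (s + 3 * m / 2) ∧
      logRate (s / (2 * s + 3 * m)) n = logRate (1 / (2 * s + 3 * m)) n ^ s ∧
      (n : ℝ) ^ (-(s / (2 * s + 3 * m))) ≤ logRate (1 / (2 * s + 3 * m)) n ^ s ∧
      1 / (logRate (1 / (2 * s + 3 * m)) n * (n : ℝ) ^ 2) ≤ rho n := by
  have hm' : (1 : ℝ) ≤ m := by exact_mod_cast hm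
  set N : ℝ := 2 * s + 3 * m with hN
  have hN1 : 1 ≤ N := by linarith
  have hN0 : 0 < N := by linarith
  filter_upwards [(tendsto_log_div_self).eventually (gt_mem_nhds one_pos),
    eventually_ge_atTop 3] with n hL1 hn3
  have hn1 : 1 ≤ n := by omega
  have hn3' : (3 : ℝ) ≤ n := by exact_mod_cast hn3
  have hn0 : (0 : ℝ) < n := by linarith
  have hlog : 1 ≤ Real.log n := by
    rw [Real.le_log_iff_exp_le hn0]
    exact Real.exp_one_lt_three.le.trans hn3'
  set L : ℝ := Real.log n / n with hL
  have hLn : 1 / (n : ℝ) ≤ L := by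
    rw [hL]
    gcongr
  have hninv : 0 < 1 / (n : ℝ) := by positivity
  have hninv1 : 1 / (n : ℝ) ≤ 1 := by
    rw [div_le_one hn0]
    linarith
  have hL0 : 0 < L := hninv.trans_le hLn
  have hu : logRate (1 / N) n = L ^ (1 / N) := logRate_eq_rpow _ hn1
  have hpow : ∀ t : ℝ, logRate (1 / N) n ^ t = L ^ (t / N) := by
    intro t
    rw [hu, ← Real.rpow_mul hL0.le]
    congr 1
    ring
  have hrho : rho n = L ^ ((1 : ℝ) / 2) := by
    rw [rho, Real.sqrt_eq_rpow]
  have hun : 1 / (n : ℝ) ≤ L ^ (1 / N) := by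
    calc 1 / (n : ℝ) ≤ (1 / (n : ℝ)) ^ (1 / N) := by
          conv_lhs => rw [← Real.rpow_one (1 / (n : ℝ))]
          refine Real.rpow_le_rpow_of_exponent_ge hninv hninv1 ?_
          rw [div_le_one hN0]
          exact hN1
      _ ≤ L ^ (1 / N) := by gcongr
  have hrhon : 1 / (n : ℝ) ≤ rho n := by
    rw [hrho]
    calc 1 / (n : ℝ) ≤ (1 / (n : ℝ)) ^ ((1 : ℝ) / 2) := by
          conv_lhs => rw [← Real.rpow_one (1 / (n : ℝ))]
          exact Real.rpow_le_rpow_of_exponent_ge hninv hninv1 (by norm_num)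
      _ ≤ _ := by gcongr
  refine ⟨?_, ?_, ?_, ?_, ?_, ?_⟩
  · rw [hu]
    positivity
  · rw [hu]
    exact Real.rpow_le_one hL0.le hL1.le (by positivity)
  · rw [hpow, hrho]
    congr 1
    rw [hN]
    field_simp
  · rw [hpow, logRate_eq_rpow _ hn1]
  · rw [hpow, Real.rpow_neg hn0.le, ← Real.inv_rpow hn0.le, ← one_div]
    gcongr
  · refine le_trans ?_ hrhon
    rw [hu]
    have h1 : 1 ≤ L ^ (1 / N) * n := by
      rwa [div_le_iff₀ hn0] at hun
    have : (n : ℝ) ≤ L ^ (1 / N) * (n : ℝ) ^ 2 := by nlinarith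
    gcongr

/-- The choice of the bandwidth balances the terms of the error bounds: for a bandwidth `c` of exact
order `u`, the error of the density estimator is of order `u^{s + m/2}`, and multiplied by the root
`u^{-m/2}` of the second moment of the kernel this is of the order `u^s` of the bias. -/
lemma exists_rate_bound {m : ℕ} {s a A C D Γ Z V : ℝ} (hs : 0 < s) (ha : 0 < a)
    (hA : 0 ≤ A) (hC : 0 ≤ C) (hD : 0 ≤ D) (hΓ : 0 ≤ Γ) (hZ : 0 ≤ Z) (hV : 0 ≤ V) :
    ∃ K : ℝ, ∀ u c E : ℝ, 0 < u → u ≤ 1 → a * u ≤ c → c ≤ A * u → 0 ≤ E →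
      E ≤ D * u ^ (s + 3 * m / 2) →
      E * (C * (c⁻¹) ^ m) + 2 * c ^ (s + m) * Γ ≤ K * u ^ (s + m / 2) ∧
      2 * E * (C * (c⁻¹) ^ m) + 2 * c ^ s * Z +
        (E * (C * (c⁻¹) ^ m) + 2 * c ^ (s + m) * Γ) *
          Real.sqrt (V * (C * (c⁻¹) ^ m + 2 * E * (C * (c⁻¹) ^ m) ^ 2)) ≤ K * u ^ s := by
  set C1 : ℝ := C * (a⁻¹) ^ m with hC1
  have hC10 : 0 ≤ C1 := by positivity
  set K1 : ℝ := D * C1 + 2 * A ^ (s + m) * Γ with hK1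
  have hK10 : 0 ≤ K1 := by positivity
  set K2 : ℝ := 2 * D * C1 + 2 * A ^ s * Z + K1 * Real.sqrt (V * (C1 + 2 * D * C1 ^ 2)) with hK2
  have hK20 : 0 ≤ K2 := by positivity
  refine ⟨K1 + K2, fun u c E hu hu1 hac hcA hE hED => ?_⟩
  have hau : 0 < a * u := by positivity
  have hc : 0 < c := hau.trans_le hac
  set Q : ℝ := C * (c⁻¹) ^ m with hQ
  have hQ0 : 0 ≤ Q := by positivity
  have hQle : Q ≤ C1 * u ^ (-(m : ℝ)) := by
    have h1 : c⁻¹ ≤ a⁻¹ * u⁻¹ := by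
      rw [← mul_inv]
      gcongr
    calc Q ≤ C * (a⁻¹ * u⁻¹) ^ m := by
          rw [hQ]
          gcongr
      _ = _ := by
          rw [hC1, mul_pow, Real.rpow_neg hu.le, Real.rpow_natCast, inv_pow u]
          ring
  have hmono : ∀ x y : ℝ, y ≤ x → u ^ x ≤ u ^ y := fun x y hxy =>
    Real.rpow_le_rpow_of_exponent_ge hu hu1 hxy
  have hm0 : (0 : ℝ) ≤ m := by positivity
  have hEQ : E * Q ≤ D * C1 * u ^ (s + m / 2) := by
    calc E * Q ≤ (D * u ^ (s + 3 * m / 2)) * (C1 * u ^ (-(m : ℝ))) := by gcongr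
      _ = D * C1 * (u ^ (s + 3 * m / 2) * u ^ (-(m : ℝ))) := by ring
      _ = _ := by
          rw [← Real.rpow_add hu]
          congr 2
          ring
  have hbias : ∀ t : ℝ, 0 < t → c ^ t ≤ A ^ t * u ^ t := by
    intro t ht
    rw [← Real.mul_rpow hA hu.le]
    gcongr
  have hη : E * Q + 2 * c ^ (s + m) * Γ ≤ K1 * u ^ (s + m / 2) := by
    have h1 : c ^ (s + m) ≤ A ^ (s + m) * u ^ (s + m / 2) := by
      refine (hbias _ (by positivity)).trans ?_
      exact mul_le_mul_of_nonneg_left (hmono _ _ (by linarith)) (by positivity)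
    calc _ ≤ D * C1 * u ^ (s + m / 2) + 2 * (A ^ (s + m) * u ^ (s + m / 2)) * Γ := by gcongr
      _ = _ := by
          rw [hK1]
          ring
  have hEQs : E * Q ≤ D * C1 * u ^ s := by
    refine hEQ.trans ?_
    exact mul_le_mul_of_nonneg_left (hmono _ _ (by linarith)) (by positivity)
  have hEQ1 : E * Q ≤ D * C1 := by
    refine hEQ.trans ?_
    refine mul_le_of_le_one_right (by positivity) (Real.rpow_le_one hu.le hu1 (by positivity))
  have hsq : Real.sqrt (V * (Q + 2 * E * Q ^ 2)) ≤
      Real.sqrt (V * (C1 + 2 * D * C1 ^ 2)) * u ^ (-(m / 2 : ℝ)) := by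
    have h1 : Q + 2 * E * Q ^ 2 ≤ (C1 + 2 * D * C1 ^ 2) * (u ^ (-(m / 2 : ℝ))) ^ 2 := by
      have h2 : (u ^ (-(m / 2 : ℝ))) ^ 2 = u ^ (-(m : ℝ)) := by
        rw [← Real.rpow_natCast, ← Real.rpow_mul hu.le]
        congr 1
        push_cast
        ring
      rw [h2]
      calc Q + 2 * E * Q ^ 2 = Q * (1 + 2 * (E * Q)) := by ring
        _ ≤ C1 * u ^ (-(m : ℝ)) * (1 + 2 * (D * C1)) := by gcongr
        _ = _ := by ring
    calc _ ≤ Real.sqrt (V * ((C1 + 2 * D * C1 ^ 2) * (u ^ (-(m / 2 : ℝ))) ^ 2)) := by gcongr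
      _ = _ := by
          rw [← mul_assoc, Real.sqrt_mul' _ (by positivity), Real.sqrt_sq (by positivity)]
  constructor
  · refine hη.trans ?_
    gcongr
    linarith
  · have h3 : (E * Q + 2 * c ^ (s + m) * Γ) * Real.sqrt (V * (Q + 2 * E * Q ^ 2)) ≤
        K1 * Real.sqrt (V * (C1 + 2 * D * C1 ^ 2)) * u ^ s := by
      calc _ ≤ (K1 * u ^ (s + m / 2)) *
            (Real.sqrt (V * (C1 + 2 * D * C1 ^ 2)) * u ^ (-(m / 2 : ℝ))) := by gcongr
        _ = K1 * Real.sqrt (V * (C1 + 2 * D * C1 ^ 2)) *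
            (u ^ (s + m / 2) * u ^ (-(m / 2 : ℝ))) := by ring
        _ = _ := by
            rw [← Real.rpow_add hu]
            congr 2
            ring
    have h4 : 2 * c ^ s * Z ≤ 2 * A ^ s * Z * u ^ s := by
      calc _ ≤ 2 * (A ^ s * u ^ s) * Z := by
            gcongr
            exact hbias s hs
        _ = _ := by ring
    have h5 : 0 ≤ K1 * u ^ s := by positivity
    have h6 : (K1 + K2) * u ^ s = K1 * u ^ s + (2 * (D * C1 * u ^ s) + 2 * A ^ s * Z * u ^ s +
        K1 * Real.sqrt (V * (C1 + 2 * D * C1 ^ 2)) * u ^ s) := by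
      rw [hK2]
      ring
    rw [h6]
    nlinarith

end Rates

/-! ### Expectations under the law of the covariates -/

section CovariateLaw

variable {m : ℕ}

/-- The law of the covariates. -/
noncomputable def covLaw (g : (Fin m → ℝ) → ℝ) : Measure (Fin m → ℝ) :=
  (volume.restrict (cube m)).withDensity fun x => ENNReal.ofReal (g x)

/-- A continuous version of the density, given by its Fourier series and cut off at the lower bound
`δ` so that it is bounded away from zero everywhere. -/
noncomputable def densRep (g : (Fin m → ℝ) → ℝ) (δ : ℝ) (x : Fin m → ℝ) : ℝ :=
  max (∑' k, fourierCoef (fun x => (g x : ℂ)) k * expi k x).re δ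

variable {g : (Fin m → ℝ) → ℝ} {s δ : ℝ}

lemma measurable_densRep (hs : 0 < s) (hg : (fun x => (g x : ℂ)) ∈ MSpace m s) :
    Measurable (densRep g δ) :=
  ((Complex.continuous_re.comp (continuous_tsum_expi (MSpace.summable_norm hs hg))).max
    continuous_const).measurable

lemma ae_eq_densRep (hs : 0 < s) (hg : (fun x => (g x : ℂ)) ∈ MSpace m s)
    (hδ : ∀ x ∈ cube m, δ ≤ g x) :
    ∀ᵐ x ∂(volume.restrict (cube m)), densRep g δ x = g x ∧
      (g x : ℂ) = ∑' k, fourierCoef (fun x => (g x : ℂ)) k * expi k x := by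
  filter_upwards [ae_eq_tsum_fourierCoef _ hg.1 (MSpace.summable_norm hs hg),
    ae_restrict_mem (measurableSet_Icc : MeasurableSet (cube m))] with x hx hxc
  refine ⟨?_, hx⟩
  rw [densRep, ← hx, Complex.ofReal_re, max_eq_left (hδ x hxc)]

lemma integral_covLaw (hg : (fun x => (g x : ℂ)) ∈ MSpace m s) (hδ0 : 0 < δ)
    (hδ : ∀ x ∈ cube m, δ ≤ g x) (φ : (Fin m → ℝ) → ℂ) :
    ∫ x, φ x ∂(covLaw g) = ∫ x in cube m, (g x : ℂ) * φ x := by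
  have hgm : AEMeasurable g (volume.restrict (cube m)) := by
    have := Complex.measurable_re.comp_aemeasurable hg.1.1.aemeasurable
    simpa [Function.comp_def] using this
  rw [covLaw, integral_withDensity_eq_integral_toReal_smul₀ hgm.ennreal_ofReal
    (ae_of_all _ fun x => ENNReal.ofReal_lt_top)]
  refine integral_congr_ae ?_
  filter_upwards [ae_restrict_mem (measurableSet_Icc : MeasurableSet (cube m))] with x hx
  rw [ENNReal.toReal_ofReal (hδ0.le.trans (hδ x hx)), Complex.real_smul]

lemma integral_expi_covLaw (hg : (fun x => (g x : ℂ)) ∈ MSpace m s) (hδ0 : 0 < δ)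
    (hδ : ∀ x ∈ cube m, δ ≤ g x) (k : Fin m → ℤ) :
    ∫ x, 1 * expi (-k) x ∂(covLaw g) = fourierCoef (fun x => (g x : ℂ)) k := by
  rw [integral_covLaw hg hδ0 hδ]
  simp only [one_mul]
  rfl

/-- Division by the density turns the expectation into an integral over the cube. -/
lemma integral_div_densRep_covLaw (hs : 0 < s) (hg : (fun x => (g x : ℂ)) ∈ MSpace m s)
    (hδ0 : 0 < δ) (hδ : ∀ x ∈ cube m, δ ≤ g x) (r : (Fin m → ℝ) → ℝ) (k : Fin m → ℤ) :
    ∫ x, ((r x * (densRep g δ x)⁻¹ : ℝ) : ℂ) * expi (-k) x ∂(covLaw g) =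
      fourierCoef (fun x => (r x : ℂ)) k := by
  rw [integral_covLaw hg hδ0 hδ]
  refine integral_congr_ae ?_
  filter_upwards [ae_eq_densRep hs hg hδ,
    ae_restrict_mem (measurableSet_Icc : MeasurableSet (cube m))] with x hx hxc
  rw [hx.1]
  have : (g x : ℂ) ≠ 0 := by exact_mod_cast (hδ0.trans_le (hδ x hxc)).ne'
  push_cast
  field_simp

lemma fourierCoef_one (k : Fin m → ℤ) :
    fourierCoef (fun _ => ((1 : ℝ) : ℂ)) k = if k = 0 then 1 else 0 := by
  have h := fourierCoef_expi (0 : Fin m → ℤ) k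
  have e : expi (0 : Fin m → ℤ) = fun _ => ((1 : ℝ) : ℂ) := by
    funext x
    simp
  rw [e] at h
  rw [h]
  simp only [eq_comm]

lemma deviation_eq_empCoef_sub {ν : Measure (Fin m → ℝ)} (q : (Fin m → ℝ) → ℂ) (a : ℕ → ℝ)
    (x : ℕ → Fin m → ℝ) (n : ℕ) (k : Fin m → ℤ) :
    deviation ν (fun y => q y * expi (-k) y) a x n =
      empCoef n x (fun j => (a j : ℂ) * q (x j)) k -
        ((1 / (n : ℝ) * ∑ j ∈ Finset.range n, a j : ℝ) : ℂ) * ∫ y, q y * expi (-k) y ∂ν := by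
  unfold deviation empCoef
  simp only [mul_sub, Finset.sum_sub_distrib, ← Finset.sum_mul]
  push_cast
  simp only [mul_assoc]

lemma deviation_one_eq {ν : Measure (Fin m → ℝ)} (q : (Fin m → ℝ) → ℂ)
    (x : ℕ → Fin m → ℝ) {n : ℕ} (hn : 1 ≤ n) (k : Fin m → ℤ) :
    deviation ν (fun y => q y * expi (-k) y) (fun _ => 1) x n =
      empCoef n x (fun j => q (x j)) k - ∫ y, q y * expi (-k) y ∂ν := by
  have hn0 : (n : ℝ) ≠ 0 := by positivity
  rw [deviation_eq_empCoef_sub]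
  simp [hn0]

end CovariateLaw

/-! ### Almost sure convergence of the estimators -/

section Convergence

variable {m : ℕ} {Ω : Type*} [MeasurableSpace Ω]

/-- The strong uniform bound of order `(log n / n)^{1/2}` for empirical Fourier coefficients with
weights `w_j q(X_j)`, in the form in which it enters the error bounds for a fixed sample. -/
lemma ae_exists_eventually_deviation_le {P : Measure Ω} [IsProbabilityMeasure P]
    {ν : Measure (Fin m → ℝ)} [IsProbabilityMeasure ν] {X : ℕ → Ω → Fin m → ℝ}
    (hX : ∀ j, Measurable (X j)) (hlaw : ∀ j, P.map (X j) = ν) (hind : iIndepFun X P)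
    {q : (Fin m → ℝ) → ℂ} (hq : Measurable q) {B : ℝ} (hB : 0 < B) (hqB : ∀ x, ‖q x‖ ≤ B) :
    ∃ D : ℝ, 0 ≤ D ∧ ∀ᵐ ω ∂P, ∀ᶠ n : ℕ in atTop, ∀ k,
      ‖empCoef n (fun j => X j ω) (fun j => q (X j ω)) k - ∫ y, q y * expi (-k) y ∂ν‖
        ≤ D * (rho n + ‖freq k‖ / (n : ℝ) ^ 2) := by
  refine ⟨devConst m B 1, by unfold devConst; positivity, ?_⟩
  filter_upwards [ae_eventually_deviation_le (m := m) hX hlaw hind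
    (φ := fun k y => q y * expi (-k) y)
    (fun k => hq.mul (continuous_expi _).measurable) hB
    (fun k x => by rw [norm_mul, norm_expi, mul_one]; exact hqB x) (fun _ => 1) one_pos
    (Eventually.of_forall fun n => by simp)] with ω hω
  filter_upwards [hω, eventually_ge_atTop 1] with n hn hn1 k
  rw [← deviation_one_eq q _ hn1]
  exact hn k

lemma add_add_mul_le {F μ κ η S K M w : ℝ} (h1 : F + η * S ≤ K * w) (h2 : μ ≤ M * w)
    (hF : 0 ≤ F) (hS : 0 ≤ η * S) (hκ : 0 ≤ κ) :
    F + μ + κ * η * S ≤ ((1 + κ) * K + M) * w := by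
  nlinarith [mul_nonneg hκ hF, mul_le_mul_of_nonneg_left h1 hκ]

lemma mean_sq_add_le {n : ℕ} (hn : 1 ≤ n) {r e : ℕ → ℝ} {R V : ℝ} (hr : ∀ j, |r j| ≤ R)
    (he : ∑ j ∈ Finset.range n, e j ^ 2 ≤ V * n) :
    1 / (n : ℝ) * ∑ j ∈ Finset.range n, (r j + e j) ^ 2 ≤ 2 * R ^ 2 + 2 * V := by
  have hn0 : (0 : ℝ) < n := by exact_mod_cast hn
  rw [one_div_mul_eq_div, div_le_iff₀ hn0]
  calc _ ≤ ∑ j ∈ Finset.range n, (2 * R ^ 2 + 2 * e j ^ 2) := by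
        refine Finset.sum_le_sum fun j _ => ?_
        have h : r j ^ 2 ≤ R ^ 2 := sq_le_sq' (abs_le.1 (hr j)).1 (abs_le.1 (hr j)).2
        nlinarith [sq_nonneg (r j - e j)]
    _ = 2 * R ^ 2 * n + 2 * ∑ j ∈ Finset.range n, e j ^ 2 := by
        rw [Finset.sum_add_distrib, Finset.mul_sum, Finset.sum_const, Finset.card_range,
          nsmul_eq_mul, mul_comm (n : ℝ)]
    _ ≤ 2 * R ^ 2 * n + 2 * (V * n) := by gcongr
    _ = _ := by ring

/-- For a bandwidth of order at least `u`, the contribution of the frequencies beyond `n²` is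
dominated by the fluctuation rate. -/
lemma mul_rho_add_le {n : ℕ} {D a u c ρ : ℝ} (hD : 0 ≤ D) (ha : 0 < a) (hu : 0 < u)
    (hc : a * u ≤ c) (hρ : 1 / (u * (n : ℝ) ^ 2) ≤ ρ) :
    D * ρ + D / (n : ℝ) ^ 2 * c⁻¹ ≤ D * (1 + a⁻¹) * ρ := by
  have h1 : D / (n : ℝ) ^ 2 * c⁻¹ ≤ D * (a⁻¹ * ρ) := by
    calc D / (n : ℝ) ^ 2 * c⁻¹ ≤ D / (n : ℝ) ^ 2 * (a * u)⁻¹ := by gcongr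
      _ = D * (a⁻¹ * (1 / (u * (n : ℝ) ^ 2))) := by
          rw [mul_inv, one_div, mul_inv]
          ring
      _ ≤ _ := by gcongr
  calc _ ≤ D * ρ + D * (a⁻¹ * ρ) := by gcongr
    _ = _ := by ring

/-- Almost sure well-definedness and uniform rate of convergence for the estimation of a regression
function `r` that is the sum of its Fourier series and whose Fourier coefficients have a finite
moment of order `s`. -/
theorem ae_eventually_regressionEst_sub_le (hm : 1 ≤ m) {P : Measure Ω} [IsProbabilityMeasure P]
    {s p : ℝ} (hs : 0 < s) (hp : 1 ≤ p)
    {r : (Fin m → ℝ) → ℝ} {ζ : (Fin m → ℤ) → ℂ}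
    (hr : ∀ y, (r y : ℂ) = ∑' k, ζ k * expi k y)
    (hζ : Summable fun k => ‖freq k‖ ^ s * ‖ζ k‖)
    {Λ : EuclideanSpace ℝ (Fin m) → ℂ} (hΛ : IsSmoothingKernel Λ) (hΛr : FiniteUpperSum Λ p)
    {g : (Fin m → ℝ) → ℝ} (hg : IsCovariateDensity g (s + m))
    {X : ℕ → Ω → Fin m → ℝ} (hX : ∀ j, Measurable (X j)) (hXlaw : ∀ j, P.map (X j) = covLaw g)
    (hXind : iIndepFun X P) {ε : ℕ → Ω → ℝ} (hε : ∀ j, Measurable (ε j))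
    (hεlaw : ∀ j, P.map (ε j) = P.map (ε 0)) (hεind : iIndepFun ε P)
    (hεmean : ∀ j, ∫ ω, ε j ω ∂P = 0) (hεL2 : ∀ j, MemLp (ε j) 2 P)
    (hXε : IndepFun (fun ω j => X j ω) (fun ω j => ε j ω) P)
    {c : ℕ → ℝ} {a A : ℝ} (ha : 0 < a)
    (hc : ∀ᶠ n : ℕ in atTop, a * logRate (1 / (2 * s + 3 * m)) n ≤ c n ∧
      c n ≤ A * logRate (1 / (2 * s + 3 * m)) n) :
    ∀ᵐ ω ∂P, ∃ K : ℝ, ∀ᶠ n : ℕ in atTop, 0 < c n ∧ (∃ Q, KernelBound Λ (c n) p Q) ∧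
      (∀ j < n, densityEst Λ (c n) n (fun i => X i ω) (X j ω) ≠ 0) ∧
      ∀ y, ‖regressionEst Λ (c n) n (fun i => X i ω) (fun i => r (X i ω) + ε i ω) y - (r y : ℂ)‖
        ≤ K * logRate (s / (2 * s + 3 * m)) n := by
  have hm' : (1 : ℝ) ≤ m := by exact_mod_cast hm
  have hsm : 0 < s + m := by positivity
  obtain ⟨δ, hδ0, hδ⟩ := hg.bounded_below
  obtain ⟨B₀, hB₀⟩ := hg.bounded_above
  set B : ℝ := max B₀ 0 with hB
  obtain ⟨C, hC0, hC⟩ := exists_kernel_sum_le hΛ (by linarith) hΛr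
  have hcov : IsProbabilityMeasure (covLaw g) := by
    rw [← hXlaw 0]
    exact Measure.isProbabilityMeasure_map (hX 0).aemeasurable
  -- the signal and the normalized density
  have hζ1 := summable_of_summable_rpow hs (fun k => norm_nonneg (ζ k)) hζ
  set R₀ : ℝ := ∑' k, ‖ζ k‖ with hR₀
  have hR₀0 : 0 ≤ R₀ := tsum_nonneg fun k => norm_nonneg _
  have hrB : ∀ y, |r y| ≤ R₀ := fun y => by
    rw [← Real.norm_eq_abs, ← Complex.norm_real, hr y]
    exact norm_tsum_expi_le hζ1 y
  have hrm : Measurable r := by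
    have h1 : r = fun y => (∑' k, ζ k * expi k y).re := by
      funext y
      rw [← hr y, Complex.ofReal_re]
    rw [h1]
    exact (Complex.continuous_re.comp (continuous_tsum_expi hζ1)).measurable
  have hrcoef : ∀ k, fourierCoef (fun y => (r y : ℂ)) k = ζ k := fun k => by
    simp only [hr]
    exact fourierCoef_tsum hζ1 k
  set h := densRep g δ with hh
  have hhm : Measurable h := measurable_densRep hsm hg.mem
  have hhδ : ∀ y, δ ≤ h y := fun y => le_max_right _ _
  have hhinv : ∀ y, |(h y)⁻¹| ≤ δ⁻¹ := fun y => by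
    rw [abs_of_nonneg (inv_nonneg.2 (hδ0.le.trans (hhδ y)))]
    exact inv_anti₀ hδ0 (hhδ y)
  set γ := fourierCoef (fun x => (g x : ℂ)) with hγ
  -- the fluctuations of the empirical Fourier coefficients
  obtain ⟨D₁, hD₁, hdev₁⟩ := ae_exists_eventually_deviation_le hX hXlaw hXind
    (q := fun _ => 1) measurable_const one_pos (fun _ => by simp)
  obtain ⟨D₂, hD₂, hdev₂⟩ := ae_exists_eventually_deviation_le hX hXlaw hXind
    (q := fun y => ((1 * (h y)⁻¹ : ℝ) : ℂ)) (by fun_prop) (inv_pos.2 hδ0)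
    (fun y => by
      rw [Complex.norm_real, one_mul, Real.norm_eq_abs]
      exact hhinv y)
  obtain ⟨D₃, hD₃, hdev₃⟩ := ae_exists_eventually_deviation_le hX hXlaw hXind
    (q := fun y => ((r y * (h y)⁻¹ : ℝ) : ℂ)) (by fun_prop)
    (B := (R₀ + 1) * δ⁻¹) (by positivity)
    (fun y => by
      rw [Complex.norm_real, Real.norm_eq_abs, abs_mul]
      have := hhinv y
      have := hrB y
      gcongr
      linarith)
  set V : ℝ := ∫ ω, ε 0 ω ^ 2 ∂P + 1 with hV
  have hε2 : 0 ≤ ∫ ω, ε 0 ω ^ 2 ∂P := integral_nonneg fun ω => sq_nonneg _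
  have hV0 : 0 < V := by linarith
  have hεV := ae_eventually_sum_sq_le hε hεind hεlaw (hεL2 0)
  have hεvar : ∀ j, ∫ ω, ε j ω ^ 2 ∂P ≤ V := fun j => by
    have h1 : ∀ i, ∫ ω, ε i ω ^ 2 ∂P = ∫ t, t ^ 2 ∂(P.map (ε i)) := fun i =>
      (integral_map (hε i).aemeasurable
        (by fun_prop : AEStronglyMeasurable (fun t : ℝ => t ^ 2) _)).symm
    rw [h1 j, hεlaw j, ← h1 0]
    linarith
  have hσ : s / (2 * s + 3 * m) < 1 / 2 := by
    rw [div_lt_div_iff₀ (by positivity) two_pos]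
    linarith
  have hmean := ae_exists_abs_mean_le hε hεind hεmean hεL2 hεvar hσ
  set D₄ : ℝ := devConst m δ⁻¹ V with hD₄'
  have hD₄ : 0 ≤ D₄ := by
    rw [hD₄', devConst]
    positivity
  have hdev₄ := ae_eventually_deviation_le_of_indepFun (m := m) hX hXlaw hXind
    (φ := fun k y => ((1 * (h y)⁻¹ : ℝ) : ℂ) * expi (-k) y)
    (fun k => Measurable.mul (by fun_prop) (continuous_expi _).measurable) (inv_pos.2 hδ0)
    (fun k y => by
      rw [norm_mul, norm_expi, mul_one, Complex.norm_real, one_mul, Real.norm_eq_abs]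
      exact hhinv y) hε hXε hV0 hεV
  -- almost surely, the sample avoids the null set where the density differs from its Fourier series
  have hsample : ∀ᵐ ω ∂P, ∀ j, (h (X j ω) ≤ B) ∧ ((h (X j ω) : ℝ) : ℂ) =
      ∑' k, γ k * expi k (X j ω) := by
    rw [ae_all_iff]
    intro j
    refine ae_of_ae_map (p := fun y => h y ≤ B ∧ ((h y : ℝ) : ℂ) = ∑' k, γ k * expi k y)
      (hX j).aemeasurable ?_
    rw [hXlaw j]
    refine (withDensity_absolutelyContinuous _ _).ae_le ?_
    filter_upwards [ae_eq_densRep hsm hg.mem hδ,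
      ae_restrict_mem (measurableSet_Icc : MeasurableSet (cube m))] with y hy hyc
    rw [hh, hy.1]
    exact ⟨(hB₀ y hyc).trans (le_max_left _ _), hy.2⟩
  set D : ℝ := D₁ + D₂ + D₃ + D₄ with hD
  have hD0 : 0 ≤ D := by positivity
  set Γ : ℝ := ∑' k, ‖freq k‖ ^ (s + m) * ‖γ k‖ with hΓ
  set Z : ℝ := ∑' k, ‖freq k‖ ^ s * ‖ζ k‖ with hZ
  have hΓ0 : 0 ≤ Γ := tsum_nonneg fun k => by positivity
  have hZ0 : 0 ≤ Z := tsum_nonneg fun k => by positivity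
  set VY : ℝ := 2 * R₀ ^ 2 + 2 * V with hVY
  have hVY0 : 0 ≤ VY := by positivity
  have hB0 : 0 ≤ B := le_max_right _ _
  obtain ⟨K, hK⟩ := exists_rate_bound (m := m) (A := |A|) (C := C) (D := D * (1 + a⁻¹)) (Γ := Γ)
    (Z := Z) (V := VY * B) hs ha (abs_nonneg A) hC0.le (by positivity) hΓ0 hZ0 (by positivity)
  set u : ℕ → ℝ := logRate (1 / (2 * s + 3 * m)) with hu
  have hu0 : Tendsto u atTop (𝓝 0) := tendsto_logRate (by positivity)
  have hη0 : Tendsto (fun n => K * u n ^ (s + m / 2)) atTop (𝓝 0) := by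
    have h1 := (hu0.rpow_const (p := s + m / 2) (Or.inr (by positivity))).const_mul K
    rwa [Real.zero_rpow (by positivity), mul_zero] at h1
  have hcA0 : Tendsto (fun n => |A| * u n) atTop (𝓝 0) := by
    simpa using hu0.const_mul |A|
  filter_upwards [hdev₁, hdev₂, hdev₃, hdev₄, hεV, hmean, hsample] with ω h₁ h₂ h₃ h₄ hεω
    ⟨M, hM0, hM⟩ hS
  refine ⟨(1 + 2 / δ ^ 2) * K + M, ?_⟩
  filter_upwards [h₁, h₂, h₃, h₄, hεω, hc, eventually_rates hm hs, eventually_ge_atTop 1,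
    hη0.eventually (ge_mem_nhds (half_pos hδ0)), hcA0.eventually (ge_mem_nhds one_pos)]
    with n h₁ h₂ h₃ h₄ hεω hcn hrate hn1 hηn hcA1
  obtain ⟨hun, hun1, hρ, htar, hnσ, hrem⟩ := hrate
  change 0 < u n at hun
  change u n ≤ 1 at hun1
  change rho n = u n ^ (s + 3 * m / 2) at hρ
  change a * u n ≤ c n ∧ c n ≤ A * u n at hcn
  change _ ≤ u n ^ s at hnσ
  change 1 / (u n * (n : ℝ) ^ 2) ≤ rho n at hrem
  rw [htar]
  change _ ∧ _ ∧ _ ∧ ∀ y, _ ≤ _ * u n ^ s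
  have hn0 : (0 : ℝ) < n := by exact_mod_cast hn1
  have hcpos : 0 < c n := lt_of_lt_of_le (by positivity) hcn.1
  have hcA : c n ≤ |A| * u n := hcn.2.trans (by gcongr; exact le_abs_self A)
  have hQ : KernelBound Λ (c n) p (C * (c n)⁻¹ ^ m) := hC (c n) hcpos (hcA.trans hcA1)
  have hρ0 : 0 ≤ rho n := Real.sqrt_nonneg _
  set A' : ℝ := D * rho n with hA'
  set T : ℝ := D / (n : ℝ) ^ 2 with hT
  have hA'0 : 0 ≤ A' := by positivity
  have hT0 : 0 ≤ T := by positivity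
  have hAT : ∀ (k : Fin m → ℤ) (D' : ℝ), D' ≤ D →
      D' * (rho n + ‖freq k‖ / (n : ℝ) ^ 2) ≤ A' + T * ‖freq k‖ := by
    intro k D' hD'
    calc _ ≤ D * (rho n + ‖freq k‖ / (n : ℝ) ^ 2) := by gcongr
      _ = _ := by
        rw [hA', hT]
        ring
  have hE : A' + T * (c n)⁻¹ ≤ D * (1 + a⁻¹) * u n ^ (s + 3 * m / 2) := by
    rw [← hρ]
    exact mul_rho_add_le hD0 ha hun hcn.1 hrem
  have hQ0 : 0 ≤ C * (c n)⁻¹ ^ m := hQ.nonneg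
  have hE0 : 0 ≤ A' + T * (c n)⁻¹ :=
    add_nonneg hA'0 (mul_nonneg hT0 (inv_nonneg.2 hcpos.le))
  obtain ⟨hK1, hK2⟩ := hK (u n) (c n) (A' + T * (c n)⁻¹) hun hun1 hcn.1 hcA hE0 hE
  set η : ℝ := (A' + T * (c n)⁻¹) * (C * (c n)⁻¹ ^ m) + 2 * c n ^ (s + m) * Γ with hη
  have hcpow : ∀ t : ℝ, 0 ≤ 2 * c n ^ t := fun t =>
    mul_nonneg two_pos.le (Real.rpow_nonneg hcpos.le t)
  have hηnn : 0 ≤ η :=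
    add_nonneg (mul_nonneg hE0 hQ0) (mul_nonneg (hcpow _) hΓ0)
  have hηδ : η ≤ δ / 2 := hK1.trans hηn
  have hdens : ∀ j, ‖densityEst Λ (c n) n (fun i => X i ω) (X j ω) - ((h (X j ω) : ℝ) : ℂ)‖
      ≤ η := by
    intro j
    rw [(hS j).2]
    refine norm_densityEst_sub_le hΛ hQ hcpos hp hA'0 hT0 (fun k => ?_) hsm hg.mem.2.2 _
    have h5 := h₁ k
    rw [integral_expi_covLaw hg.mem hδ0 hδ] at h5
    exact h5.trans (hAT k D₁ (by linarith))
  refine ⟨hcpos, ⟨_, hQ⟩, fun j _ => ?_, fun y => ?_⟩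
  · exact (norm_inv_sub_inv_le hδ0 (hhδ _) (hdens j) hηδ).1
  have hunif : ∀ k, ‖empCoef n (fun i => X i ω) (fun j => (((h (X j ω))⁻¹ : ℝ) : ℂ)) k -
      if k = 0 then 1 else 0‖ ≤ A' + T * ‖freq k‖ := by
    intro k
    have h5 := h₂ k
    rw [integral_div_densRep_covLaw hsm hg.mem hδ0 hδ (fun _ => 1), fourierCoef_one] at h5
    simp only [one_mul] at h5
    exact h5.trans (hAT k D₂ (by linarith))
  have hsig : ∀ k, ‖empCoef n (fun i => X i ω)
      (fun j => ((r (X j ω) * (h (X j ω))⁻¹ : ℝ) : ℂ)) k - ζ k‖ ≤ A' + T * ‖freq k‖ := by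
    intro k
    have h5 := h₃ k
    rw [integral_div_densRep_covLaw hsm hg.mem hδ0 hδ r, hrcoef] at h5
    exact h5.trans (hAT k D₃ (by linarith))
  have hnoise : ∀ k, ‖empCoef n (fun i => X i ω)
      (fun j => ((ε j ω * (h (X j ω))⁻¹ : ℝ) : ℂ)) k -
      if k = 0 then ((1 / (n : ℝ) * ∑ j ∈ Finset.range n, ε j ω : ℝ) : ℂ) else 0‖
        ≤ A' + T * ‖freq k‖ := by
    intro k
    have h5 := h₄ k
    rw [deviation_eq_empCoef_sub, integral_div_densRep_covLaw hsm hg.mem hδ0 hδ (fun _ => 1),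
      fourierCoef_one] at h5
    simp only [one_mul, mul_ite, mul_one, mul_zero, ← Complex.ofReal_mul] at h5
    exact h5.trans (hAT k D₄ (by linarith))
  have hY : 1 / (n : ℝ) * ∑ j ∈ Finset.range n, (r (X j ω) + ε j ω) ^ 2 ≤ VY :=
    mean_sq_add_le hn1 (fun j => hrB (X j ω)) hεω
  have hfin := norm_regressionEst_sub_le (x := fun i => X i ω) (h := fun j => h (X j ω))
    (r := fun j => r (X j ω)) (e := fun j => ε j ω) hΛ hQ hcpos hp hA'0 hT0 hδ0
    (fun j => hhδ _) (fun j => (hS j).1) (fun j _ => hdens j) hηnn hηδ hunif hsig hnoise hY hs hζ y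
  rw [hr y]
  refine hfin.trans ?_
  have hMn := (hM n hn1).trans (mul_le_mul_of_nonneg_left hnσ hM0)
  rw [mul_assoc VY B] at hK2
  refine add_add_mul_le hK2 hMn ?_ (mul_nonneg hηnn (Real.sqrt_nonneg _))
    (div_nonneg two_pos.le (sq_nonneg δ))
  exact add_nonneg (mul_nonneg (mul_nonneg two_pos.le hE0) hQ0) (mul_nonneg (hcpow _) hZ0)

end Convergence

end IndirectRegression

open IndirectRegression in
theorem theorem1
    {m : ℕ} (hm : 1 ≤ m)
    {Ω : Type*} [MeasurableSpace Ω] (P : Measure Ω) [IsProbabilityMeasure P]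
    -- the regression function, the distortion function and the degree of ill-posedness
    (s₀ b : ℝ) (hs₀ : 0 < s₀) (hb : 0 ≤ b)
    (θ ψ : (Fin m → ℝ) → ℝ)
    (hθ : (fun x => (θ x : ℂ)) ∈ IndirectRegression.MSpace m s₀)
    (hψ : IndirectRegression.IsDistortion ψ)
    (hψb : IndirectRegression.IllPosed ψ b)
    -- the smoothing kernel
    (Λ : EuclideanSpace ℝ (Fin m) → ℂ)
    (hΛ : IndirectRegression.IsSmoothingKernel Λ)
    (hΛm : IndirectRegression.FiniteMoment Λ (max (s₀ + b) 1))
    (hΛr : IndirectRegression.FiniteUpperSum Λ (max (s₀ + b) 1))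
    -- the i.i.d. covariates with density `g`
    (g : (Fin m → ℝ) → ℝ)
    (hg : IndirectRegression.IsCovariateDensity g (s₀ + b + m))
    (X : ℕ → Ω → Fin m → ℝ) (hX : ∀ j, Measurable (X j))
    (hXlaw : ∀ j, P.map (X j) =
      (volume.restrict (IndirectRegression.cube m)).withDensity (fun x => ENNReal.ofReal (g x)))
    (hXindep : iIndepFun X P)
    -- the i.i.d. centred errors with density `f` and a moment of order `κ > 2`
    (f : ℝ → ℝ) (hf : Measurable f) (hf0 : ∀ t, 0 ≤ f t)
    (ε : ℕ → Ω → ℝ) (hε : ∀ j, Measurable (ε j))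
    (hεlaw : ∀ j, P.map (ε j) = volume.withDensity (fun t => ENNReal.ofReal (f t)))
    (hεindep : iIndepFun ε P)
    (hεmean : ∀ j, ∫ ω, ε j ω ∂P = 0)
    (κ : ℝ) (hκ : 2 < κ) (hεκ : ∀ j, Integrable (fun ω => |ε j ω| ^ κ) P)
    (hXε : IndepFun (fun ω j => X j ω) (fun ω j => ε j ω) P)
    -- the responses
    (Y : ℕ → Ω → ℝ)
    (hY : ∀ j ω, Y j ω = IndirectRegression.convOp ψ θ (X j ω) + ε j ω)
    -- the bandwidth, of exact order `(log n / n)^{1/(2s₀+2b+3m)}`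
    (c : ℕ → ℝ)
    (hc : ∃ a A : ℝ, 0 < a ∧ ∀ᶠ n : ℕ in atTop,
      a * IndirectRegression.logRate (1 / (2 * s₀ + 2 * b + 3 * m)) n ≤ c n ∧
      c n ≤ A * IndirectRegression.logRate (1 / (2 * s₀ + 2 * b + 3 * m)) n) :
    -- the estimator is well defined for all large `n`
    (∀ᵐ ω ∂P, ∀ᶠ n : ℕ in atTop,
      (Summable fun k : Fin m → ℤ => Λ (c n • IndirectRegression.freq k)) ∧
      ∀ j < n, IndirectRegression.densityEst Λ (c n) n (fun i => X i ω) (X j ω) ≠ 0) ∧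
    -- uniform almost sure rate of convergence
    (∀ᵐ ω ∂P, ∃ D : ℝ, ∀ᶠ n : ℕ in atTop, ∀ x ∈ IndirectRegression.cube m,
      ‖IndirectRegression.regressionEst Λ (c n) n (fun i => X i ω) (fun i => Y i ω) x
          - (IndirectRegression.convOp ψ θ x : ℂ)‖
        ≤ D * IndirectRegression.logRate ((s₀ + b) / (2 * s₀ + 2 * b + 3 * m)) n) ∧
    -- the estimation error lies in the unit ball of `M(s₀ + b)`
    (∀ᵐ ω ∂P, ∀ᶠ n : ℕ in atTop,
      (fun x => IndirectRegression.regressionEst Λ (c n) n (fun i => X i ω) (fun i => Y i ω) x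
          - (IndirectRegression.convOp ψ θ x : ℂ))
        ∈ IndirectRegression.MUnitBall m (s₀ + b)) := by
  have hs : 0 < s₀ + b := by linarith
  have hp : 1 ≤ max (s₀ + b) 1 := le_max_right _ _
  have hN : 2 * s₀ + 2 * b + 3 * (m : ℝ) = 2 * (s₀ + b) + 3 * m := by ring
  have hN0 : 0 < 2 * (s₀ + b) + 3 * (m : ℝ) := by positivity
  rw [hN] at hc ⊢
  obtain ⟨a, A, ha, hc⟩ := hc
  have hr := convOp_eq_tsum hs₀ hθ hψ
  have hζ := summable_convCoef hs₀ hb hθ hψb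
  have hYeq : ∀ ω, (fun i => Y i ω) = fun i => convOp ψ θ (X i ω) + ε i ω :=
    fun ω => funext fun i => hY i ω
  have main := ae_eventually_regressionEst_sub_le hm hs hp hr hζ hΛ hΛr hg hX hXlaw hXindep hε
    (fun j => (hεlaw j).trans (hεlaw 0).symm) hεindep hεmean
    (fun j => memLp_two_of_integrable_abs_rpow (hε j) hκ (hεκ j)) hXε ha hc
  refine ⟨?_, ?_, ?_⟩
  · filter_upwards [main] with ω ⟨K, hK⟩
    filter_upwards [hK] with n ⟨_, ⟨Q, hQ⟩, hne, _⟩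
    exact ⟨hQ.summable.of_norm, hne⟩
  · filter_upwards [main] with ω ⟨K, hK⟩
    refine ⟨K, ?_⟩
    filter_upwards [hK] with n ⟨_, _, _, hle⟩ x _
    rw [hYeq]
    exact hle x
  · filter_upwards [main] with ω ⟨K, hK⟩
    have hlim : Tendsto (fun n => K * logRate ((s₀ + b) / (2 * (s₀ + b) + 3 * m)) n) atTop
        (𝓝 0) := by
      simpa using (tendsto_logRate (div_pos hs hN0)).const_mul K
    filter_upwards [hK, hlim.eventually (ge_mem_nhds one_pos)] with n ⟨hcn, ⟨Q, hQ⟩, _, hle⟩ h1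
    refine ⟨?_, fun x _ => ?_⟩
    · simp only [hr]
      exact regressionEst_sub_mem_MSpace hs (le_max_left _ _) hQ hcn _ hζ
    · simp only [hYeq]
      exact (hle x).trans h1
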